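/- Let $a<b$, $n\ge 1$, and let $H\in L_1\big((a-b,b-a);\mathbb C^{n\times n}\big)$ be even, i.e. $H(-t)=H(t)$ for almost every $t$. Suppose that for every $\xi\in[a,b]$ the equation $$g(t,\xi)+\int_a^\xi H(t-s)\,g(s,\xi)\,ds=I\qquad(a\le t\le\xi)$$ has a unique continuous $n\times n$ matrix solution $g(\cdot,\xi)$ on $[a,\xi]$. Then for every $\xi\in[a,b]$ the equation $$g^*(t,\xi)+\int_a^\xi g^*(s,\xi)\,H(s-t)\,ds=I\qquad(a\le t\le\xi)$$ also has a unique continuous solution $g^*(\cdot,\xi)$ on $[a,\xi]$ (the star is part of the name and is not the conjugate transpose), and $$\det\big[g^*(\xi,\xi)\,g(\xi,\xi)\big]\ne0\qquad(a\le\xi\le b).$$ The function $M(\xi)=\int_a^\xi g(t,\xi)\,dt$ is differentiable on $[a,b]$ with $M'(\xi)=g^*(\xi,\xi)g(\xi,\xi)$ (derivatives at end points are one-sided). For every continuous $f:[a,b]\to\mathbb C^n$ the function $\xi\mapsto\int_a^\xi g^*(s,\xi)f(s)\,ds$ is differentiable on $[a,b]$, the function $$F(\xi)=M'(\xi)^{-1}\,\frac{d}{d\xi}\int_a^\xi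 g^*(s,\xi)f(s)\,ds$$ is continuous on $[a,b]$, and the equation $$\varphi(t)+\int_a^b H(t-s)\varphi(s)\,ds=f(t)\qquad(a\le t\le b)$$ has a unique continuous solution $\varphi$, given by $$\varphi(t)=g(t,b)F(b)-\int_t^b g(t,\xi)\,dF(\xi)\qquad(a\le t\le b),$$ where the integral exists as a Riemann--Stieltjes integral. If $f$ is absolutely continuous on $[a,b]$, then $F$ is absolutely continuous on $[a,b]$, hence differentiable almost everywhere, and $$\varphi(t)=g(t,b)F(b)-\int_t^b g(t,\xi)\,\frac{dF}{d\xi}(\xi)\,d\xi\qquad(a\le t\le b)$$ with a Lebesgue integral. -/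

import Mathlib

open Set MeasureTheory
open scoped Matrix

noncomputable section

namespace KreinMethod

/-- Entrywise integral `∫_c^d A(s) ds` of a matrix function. -/
def matIntegral {n : ℕ} (A : ℝ → Matrix (Fin n) (Fin n) ℂ) (c d : ℝ) :
    Matrix (Fin n) (Fin n) ℂ :=
  Matrix.of fun i j => ∫ s in c..d, A s i j

/-- Entrywise derivative at `ξ` of a matrix function on the set `S`. -/
def matDerivWithin {n : ℕ} (A : ℝ → Matrix (Fin n) (Fin n) ℂ) (S : Set ℝ) (ξ : ℝ) :
    Matrix (Fin n) (Fin n) ℂ :=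
  Matrix.of fun i j => derivWithin (fun η => A η i j) S ξ

/-- `H` is an integrable matrix function on `(-r, r)`. -/
def IsIntegrableKernel {n : ℕ} (H : ℝ → Matrix (Fin n) (Fin n) ℂ) (r : ℝ) : Prop :=
  ∀ i j, IntegrableOn (fun t => H t i j) (Ioo (-r) r)

/-- `H` is even, as an element of `L₁(-r, r)`: `H(-t) = H(t)` for almost every `t`. -/
def IsEvenKernel {n : ℕ} (H : ℝ → Matrix (Fin n) (Fin n) ℂ) (r : ℝ) : Prop :=
  ∀ᵐ t ∂(volume.restrict (Ioo (-r) r)), H (-t) = H t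

/-- `u` is a continuous solution on `[a, ξ]` of `u(t) + ∫_a^ξ H(t-s) u(s) ds = I`. -/
def IsTruncatedSolution {n : ℕ} (H : ℝ → Matrix (Fin n) (Fin n) ℂ) (a ξ : ℝ)
    (u : ℝ → Matrix (Fin n) (Fin n) ℂ) : Prop :=
  ContinuousOn u (Icc a ξ) ∧
    ∀ t ∈ Icc a ξ, u t + matIntegral (fun s => H (t - s) * u s) a ξ = 1

/-- `u` is a continuous solution on `[a, ξ]` of `u(t) + ∫_a^ξ u(s) H(s-t) ds = I`. -/
def IsDualTruncatedSolution {n : ℕ} (H : ℝ → Matrix (Fin n) (Fin n) ℂ) (a ξ : ℝ)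
    (u : ℝ → Matrix (Fin n) (Fin n) ℂ) : Prop :=
  ContinuousOn u (Icc a ξ) ∧
    ∀ t ∈ Icc a ξ, u t + matIntegral (fun s => u s * H (s - t)) a ξ = 1

/-- `φ` is a continuous solution on `[a, b]` of `φ(t) + ∫_a^b H(t-s) φ(s) ds = f(t)`. -/
def IsSolution {n : ℕ} (H : ℝ → Matrix (Fin n) (Fin n) ℂ) (a b : ℝ)
    (f φ : ℝ → Fin n → ℂ) : Prop :=
  ContinuousOn φ (Icc a b) ∧
    ∀ t ∈ Icc a b, φ t + ∫ s in a..b, H (t - s) *ᵥ φ s = f t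

/-- `u` has the property `P`, and is the only such function up to values outside `[c, d]`. -/
def IsUniqueOn {E : Type*} (P : (ℝ → E) → Prop) (c d : ℝ) (u : ℝ → E) : Prop :=
  P u ∧ ∀ v, P v → EqOn v u (Icc c d)

/-- `M(ξ) = ∫_a^ξ g(t, ξ) dt`. -/
def M {n : ℕ} (g : ℝ → ℝ → Matrix (Fin n) (Fin n) ℂ) (a ξ : ℝ) : Matrix (Fin n) (Fin n) ℂ :=
  matIntegral (fun t => g t ξ) a ξ

/-- `∫_a^ξ g*(s, ξ) f(s) ds`. -/
def dualMoment {n : ℕ} (gs : ℝ → ℝ → Matrix (Fin n) (Fin n) ℂ) (f : ℝ → Fin n → ℂ) (a ξ : ℝ) :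
    Fin n → ℂ :=
  ∫ s in a..ξ, gs s ξ *ᵥ f s

/-- `F(ξ) = M'(ξ)⁻¹ (d/dξ) ∫_a^ξ g*(s, ξ) f(s) ds` for `ξ ∈ [a, b]`, with one-sided derivatives at
the end points. -/
def kreinF {n : ℕ} (g gs : ℝ → ℝ → Matrix (Fin n) (Fin n) ℂ) (f : ℝ → Fin n → ℂ) (a b ξ : ℝ) :
    Fin n → ℂ :=
  (matDerivWithin (M g a) (Icc a b) ξ)⁻¹ *ᵥ derivWithin (dualMoment gs f a) (Icc a b) ξ

/-- `J` is the Riemann-Stieltjes integral `∫_c^d A(ξ) dF(ξ)`: the limit, as the mesh tends to `0`,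
of the sums `∑ A(τ_i) (F(x_{i+1}) - F(x_i))` over partitions `c = x_0 ≤ … ≤ x_N = d` with tags
`τ_i ∈ [x_i, x_{i+1}]`. -/
def HasStieltjesIntegral {n : ℕ} (A : ℝ → Matrix (Fin n) (Fin n) ℂ) (F : ℝ → Fin n → ℂ)
    (c d : ℝ) (J : Fin n → ℂ) : Prop :=
  ∀ ε > (0 : ℝ), ∃ δ > (0 : ℝ), ∀ (N : ℕ) (x τ : ℕ → ℝ), x 0 = c → x N = d →
    (∀ i < N, x i ≤ τ i ∧ τ i ≤ x (i + 1) ∧ x (i + 1) - x i < δ) →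
    ‖(∑ i ∈ Finset.range N, A (τ i) *ᵥ (F (x (i + 1)) - F (x i))) - J‖ < ε

end KreinMethod

end

/-
The kernel acts on column vectors, on matrices from the left and on matrices from the right;
unique solvability makes every truncated operator injective, hence invertible with a bound
uniform in the truncation, and solutions extended to the square depend continuously on both
variables. Pairing a solution `φ` of the equation with a solution `χ` of the dual one gives
`∫_a^η f' φ_η - ∫_a^ξ χ_ξ f = ∫_ξ^η χ_ξ φ_η`, so both moments have derivative `χ_ξ(ξ) φ_ξ(ξ)`;
in particular `M' = g*(ξ, ξ) g(ξ, ξ)` and `F(ξ) = g(ξ, ξ)⁻¹ φ_ξ(ξ)`. Evenness of the kernel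
gives a reflection symmetry which forces `g(ξ, ξ)` and `g*(ξ, ξ)` to be nonsingular. Finally, on
a short cell the increment of `φ_ξ(t) - g(t, ξ) F(x)` in `ξ` is driven by its values near the
diagonal, where it is small because `φ_ξ(ξ) = g(ξ, ξ) F(ξ)`; summation by parts turns this into
the Stieltjes formula.
-/

noncomputable section

namespace KreinMethod

open Filter Topology

section Kernels

variable {V : Type*} [NormedAddCommGroup V] [NormedSpace ℝ V] {k : ℝ → V →L[ℝ] V}
  {u v : ℝ → V} {a c d m ξ η t : ℝ}

/-- The convolution of the operator-valued kernel `k` with `u`, truncated to `[a, ξ]`. -/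
def truncConv (k : ℝ → V →L[ℝ] V) (a ξ : ℝ) (u : ℝ → V) (t : ℝ) : V :=
  ∫ s in a..ξ, k (t - s) (u s)

lemma intervalIntegrable_norm_comp_sub {E : Type*} [NormedAddCommGroup E] {f : ℝ → E}
    (hf : Integrable f) (t c d : ℝ) : IntervalIntegrable (fun s => ‖f (t - s)‖) volume c d :=
  (hf.norm.comp_sub_left t).intervalIntegrable

lemma integral_norm_comp_sub_le {E : Type*} [NormedAddCommGroup E] {f : ℝ → E}
    (hf : Integrable f) (hcd : c ≤ d) (t : ℝ) : ∫ s in c..d, ‖f (t - s)‖ ≤ ∫ x, ‖f x‖ := by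
  rw [intervalIntegral.integral_of_le hcd, ← integral_sub_left_eq_self (fun x => ‖f x‖) volume t]
  exact setIntegral_le_integral (hf.norm.comp_sub_left t) (ae_of_all _ fun _ => norm_nonneg _)

lemma intervalIntegrable_kernel_apply (hk : Integrable k) (hu : Continuous u) (t c d : ℝ) :
    IntervalIntegrable (fun s => k (t - s) (u s)) volume c d := by
  obtain ⟨m, hm⟩ := isCompact_uIcc.exists_bound_of_continuousOn (hu.continuousOn (s := uIcc c d))
  refine ((intervalIntegrable_norm_comp_sub hk t c d).mul_const m).mono_fun'
    ((ContinuousLinearMap.id ℝ (V →L[ℝ] V)).aestronglyMeasurable_comp₂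
      (hk.comp_sub_left t).aestronglyMeasurable.restrict hu.aestronglyMeasurable)
    ((ae_restrict_iff' measurableSet_uIoc).2 (ae_of_all _ fun s hs => ?_))
  exact (k (t - s)).le_opNorm_of_le (hm s (uIoc_subset_uIcc hs))

lemma norm_integral_kernel_apply_le (hk : Integrable k) (hcd : c ≤ d)
    (hu : ∀ s ∈ Icc c d, ‖u s‖ ≤ m) (t : ℝ) :
    ‖∫ s in c..d, k (t - s) (u s)‖ ≤ m * ∫ s in c..d, ‖k (t - s)‖ := by
  rw [mul_comm, ← intervalIntegral.integral_mul_const]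
  exact intervalIntegral.norm_integral_le_of_norm_le hcd
    (ae_of_all _ fun s hs => (k (t - s)).le_opNorm_of_le (hu s (Ioc_subset_Icc_self hs)))
    ((intervalIntegrable_norm_comp_sub hk t c d).mul_const m)

lemma norm_truncConv_le (hk : Integrable k) (hξ : a ≤ ξ) (hm : 0 ≤ m)
    (hu : ∀ s ∈ Icc a ξ, ‖u s‖ ≤ m) (t : ℝ) : ‖truncConv k a ξ u t‖ ≤ m * ∫ x, ‖k x‖ :=
  (norm_integral_kernel_apply_le hk hξ hu t).trans
    (mul_le_mul_of_nonneg_left (integral_norm_comp_sub_le hk hξ t) hm)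

lemma truncConv_congr (hξ : a ≤ ξ) (huv : EqOn u v (Icc a ξ)) :
    truncConv k a ξ u t = truncConv k a ξ v t :=
  intervalIntegral.integral_congr fun s hs => by
    rw [uIcc_of_le hξ] at hs
    simp only [huv hs]

lemma truncConv_add (hk : Integrable k) (hu : Continuous u) (hv : Continuous v) :
    truncConv k a ξ (fun s => u s + v s) t = truncConv k a ξ u t + truncConv k a ξ v t := by
  simp only [truncConv, map_add]
  exact intervalIntegral.integral_add (intervalIntegrable_kernel_apply hk hu t a ξ)
    (intervalIntegrable_kernel_apply hk hv t a ξ)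

lemma truncConv_sub (hk : Integrable k) (hu : Continuous u) (hv : Continuous v) :
    truncConv k a ξ (fun s => u s - v s) t = truncConv k a ξ u t - truncConv k a ξ v t := by
  simp only [truncConv, map_sub]
  exact intervalIntegral.integral_sub (intervalIntegrable_kernel_apply hk hu t a ξ)
    (intervalIntegrable_kernel_apply hk hv t a ξ)

lemma truncConv_eq_add_integral (hk : Integrable k) (hu : Continuous u) (ξ η : ℝ) :
    truncConv k a η u t = truncConv k a ξ u t + ∫ s in ξ..η, k (t - s) (u s) :=
  (intervalIntegral.integral_add_adjacent_intervals (intervalIntegrable_kernel_apply hk hu t a ξ)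
    (intervalIntegrable_kernel_apply hk hu t ξ η)).symm

section Map

variable {W : Type*} [NormedAddCommGroup W] [NormedSpace ℝ W] [CompleteSpace V] [CompleteSpace W]

lemma clm_truncConv (P : V →L[ℝ] W) (hk : Integrable k) (hu : Continuous u) :
    P (truncConv k a ξ u t) = ∫ s in a..ξ, P (k (t - s) (u s)) :=
  (P.intervalIntegral_comp_comm (intervalIntegrable_kernel_apply hk hu t a ξ)).symm

lemma map_truncConv {l : ℝ → W →L[ℝ] W} (P : V →L[ℝ] W) (hP : ∀ x v, P (k x v) = l x (P v))
    (hk : Integrable k) (hu : Continuous u) :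
    P (truncConv k a ξ u t) = truncConv l a ξ (fun s => P (u s)) t := by
  rw [clm_truncConv P hk hu]
  simp only [hP, truncConv]

end Map

lemma tendsto_integral_norm_translate_sub {E : Type*} [NormedAddCommGroup E] {f : ℝ → E}
    (hf : Integrable f) : Tendsto (fun h => ∫ x, ‖f (h + x) - f x‖) (𝓝 0) (𝓝 0) := by
  have : Fact ((1 : ENNReal) ≠ ⊤) := ⟨ENNReal.one_ne_top⟩
  have hL := memLp_one_iff_integrable.2 hf
  have hdist (h : ℝ) : dist (DomAddAct.mk h +ᵥ hL.toLp f) (hL.toLp f) = ∫ x, ‖f (h + x) - f x‖ := by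
    rw [DomAddAct.mk_vadd_toLp, dist_eq_norm, ← MemLp.toLp_sub]
    exact L1.norm_of_fun_eq_integral_norm ((hf.comp_add_left h).sub hf)
  have hcont : Continuous fun h : ℝ => dist (DomAddAct.mk h +ᵥ hL.toLp f) (hL.toLp f) :=
    ((DomAddAct.continuous_mk.vadd continuous_const).dist continuous_const)
  simpa [hdist] using hcont.tendsto 0

lemma norm_truncConv_sub_truncConv_le (hk : Integrable k) (hξ : a ≤ ξ) (hu : Continuous u)
    (hm : 0 ≤ m) (hum : ∀ s ∈ Icc a ξ, ‖u s‖ ≤ m) (t t' : ℝ) :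
    ‖truncConv k a ξ u t - truncConv k a ξ u t'‖ ≤ m * ∫ x, ‖k (t - t' + x) - k x‖ := by
  have hshift : Integrable fun x => k (t - t' + x) - k x := (hk.comp_add_left _).sub hk
  have heq : truncConv k a ξ u t - truncConv k a ξ u t' =
      truncConv (fun x => k (t - t' + x) - k x) a ξ u t' := by
    simp only [truncConv]
    rw [← intervalIntegral.integral_sub (intervalIntegrable_kernel_apply hk hu t a ξ)
      (intervalIntegrable_kernel_apply hk hu t' a ξ)]
    simp only [sub_add_sub_cancel, sub_apply]
  rw [heq]
  exact norm_truncConv_le hshift hξ hm hum t'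

lemma continuous_truncConv (hk : Integrable k) (hξ : a ≤ ξ) (hu : Continuous u) :
    Continuous (truncConv k a ξ u) := by
  obtain ⟨m, hm⟩ := isCompact_Icc.exists_bound_of_continuousOn (hu.continuousOn (s := Icc a ξ))
  have hm0 : 0 ≤ m := (norm_nonneg _).trans (hm a ⟨le_rfl, hξ⟩)
  refine continuous_iff_continuousAt.2 fun t₀ => tendsto_iff_norm_sub_tendsto_zero.2 ?_
  have hsub : Tendsto (fun t => t - t₀) (𝓝 t₀) (𝓝 0) := by
    simpa using (continuous_sub_right t₀).tendsto t₀
  refine squeeze_zero (fun _ => norm_nonneg _)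
    (fun t => norm_truncConv_sub_truncConv_le hk hξ hu hm0 hm t t₀) ?_
  simpa using ((tendsto_integral_norm_translate_sub hk).comp hsub).const_mul m

lemma exists_sum_integral_norm_lt {E ι : Type*} [NormedAddCommGroup E] {f : ℝ → E}
    (hf : Integrable f) {ε : ℝ} (hε : 0 < ε) :
    ∃ δ > 0, ∀ (I : Finset ι) (α β : ι → ℝ), (∀ i ∈ I, α i ≤ β i) →
      ((I : Set ι).PairwiseDisjoint fun i => Ioc (α i) (β i)) → ∑ i ∈ I, (β i - α i) < δ →
      ∀ t, ∑ i ∈ I, ∫ s in α i..β i, ‖f (t - s)‖ < ε := by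
  obtain ⟨δ, hδ, h⟩ := exists_pos_setLIntegral_lt_of_measure_lt (μ := volume)
    (f := fun x => ‖f x‖ₑ) hf.2.ne (ENNReal.ofReal_pos.2 hε).ne'
  obtain ⟨δ', _, hδδ'⟩ := ENNReal.lt_iff_exists_real_btwn.1 hδ
  refine ⟨δ', ENNReal.ofReal_pos.1 hδδ'.1, fun I α β hαβ hdisj hlen t => ?_⟩
  set A : Set ℝ := ⋃ i ∈ I, Ioc (α i) (β i) with hA
  have hAm : MeasurableSet A := I.measurableSet_biUnion fun _ _ => measurableSet_Ioc
  have hrefl : MeasurePreserving (fun s : ℝ => t - s) := Measure.measurePreserving_sub_left volume t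
  have hvol : volume ((fun s => t - s) ⁻¹' A) < δ := by
    rw [hrefl.measure_preimage hAm.nullMeasurableSet, hA,
      measure_biUnion_finset hdisj fun _ _ => measurableSet_Ioc]
    simp only [Real.volume_Ioc]
    rw [← ENNReal.ofReal_sum_of_nonneg fun i hi => sub_nonneg.2 (hαβ i hi)]
    exact ((ENNReal.ofReal_lt_ofReal_iff (ENNReal.ofReal_pos.1 hδδ'.1)).2 hlen).trans hδδ'.2
  have hint : ∑ i ∈ I, ∫ s in α i..β i, ‖f (t - s)‖ = ∫ s in A, ‖f (t - s)‖ := by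
    rw [hA, integral_biUnion_finset I (fun _ _ => measurableSet_Ioc) hdisj
      fun i _ => (hf.norm.comp_sub_left t).integrableOn]
    exact Finset.sum_congr rfl fun i hi => intervalIntegral.integral_of_le (hαβ i hi)
  have hpre : (fun s => t - s) ⁻¹' ((fun s => t - s) ⁻¹' A) = A := by
    ext s; simp
  rw [hint, integral_norm_eq_lintegral_enorm (hf.comp_sub_left t).aestronglyMeasurable.restrict,
    ← hpre, hrefl.setLIntegral_comp_preimage_emb (Homeomorph.subLeft t).measurableEmbedding
      (fun x => ‖f x‖ₑ)]
  exact ENNReal.toReal_lt_of_lt_ofReal (h _ hvol)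

lemma exists_integral_norm_lt {E : Type*} [NormedAddCommGroup E] {f : ℝ → E} (hf : Integrable f)
    {ε : ℝ} (hε : 0 < ε) :
    ∃ δ > 0, ∀ c d, c ≤ d → d - c < δ → ∀ t, ∫ s in c..d, ‖f (t - s)‖ < ε := by
  obtain ⟨δ, hδ, h⟩ := exists_sum_integral_norm_lt (ι := Unit) hf hε
  exact ⟨δ, hδ, fun c d hcd hlen t => by
    simpa using h {()} (fun _ => c) (fun _ => d) (by simpa using hcd) (by simp)
      (by simpa using hlen) t⟩

end Kernels

section Fredholm

open scoped BoundedContinuousFunction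

/-- Homogeneous truncated equations on `[a, ξ]`, `a ≤ ξ ≤ b`, have only the zero solution. -/
def InjectiveTruncations {V : Type*} [NormedAddCommGroup V] [NormedSpace ℝ V]
    (k : ℝ → V →L[ℝ] V) (a b : ℝ) : Prop :=
  ∀ ξ ∈ Icc a b, ∀ u : ℝ → V, Continuous u →
    (∀ t ∈ Icc a ξ, u t + truncConv k a ξ u t = 0) → ∀ t ∈ Icc a ξ, u t = 0

/-- `φ ξ` solves the equation truncated to `[a, ξ]` with right side `f`, on all of `[a, b]` and
jointly continuously. -/
structure IsSolutionFamily {V : Type*} [NormedAddCommGroup V] [NormedSpace ℝ V]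
    (k : ℝ → V →L[ℝ] V) (a b : ℝ) (f : ℝ → V) (φ : ℝ → ℝ → V) : Prop where
  continuous : Continuous fun p : ℝ × ℝ => φ p.1 p.2
  eq : ∀ ξ ∈ Icc a b, ∀ t ∈ Icc a b, φ ξ t + truncConv k a ξ (φ ξ) t = f t

lemma exists_continuous_inverse_one_add {X K : Type*} [NormedAddCommGroup X] [NormedSpace ℝ X]
    [CompleteSpace X] [TopologicalSpace K] [CompactSpace K] {T : K → X →L[ℝ] X}
    (hT : Continuous T) (hcomp : ∀ x, IsCompactOperator (T x))
    (hinj : ∀ x v, v + T x v = 0 → v = 0) :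
    ∃ R : K → X →L[ℝ] X, Continuous R ∧ (∀ x v, R x v + T x (R x v) = v) ∧
      ∃ C, 0 ≤ C ∧ ∀ x, ‖R x‖ ≤ C := by
  have hunit (x : K) : IsUnit (1 + T x) := by
    rcases (hcomp x).hasEigenvalue_or_mem_resolventSet (neg_ne_zero.2 one_ne_zero) with h | h
    · obtain ⟨v, hv⟩ := h.exists_hasEigenvector
      have hv1 : T x v = (-1 : ℝ) • v := hv.apply_eq_smul
      exact absurd (hinj x v (by rw [hv1, neg_one_smul, add_neg_cancel])) hv.2
    · have h1 : IsUnit (algebraMap ℝ (X →L[ℝ] X) (-1) - T x) := h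
      rw [map_neg, map_one, ← neg_add'] at h1
      simpa only [neg_neg] using h1.neg
  have hR : Continuous fun x => Ring.inverse (1 + T x) := by
    refine continuous_iff_continuousAt.2 fun x => ?_
    obtain ⟨w, hw⟩ := hunit x
    have h1 := NormedRing.inverse_continuousAt w
    rw [hw] at h1
    exact h1.comp (f := fun x => 1 + T x) (continuous_const.add hT).continuousAt
  obtain ⟨C, hC⟩ := isCompact_univ.exists_bound_of_continuousOn hR.continuousOn
  exact ⟨_, hR,
    fun x v => congrArg (fun A : X →L[ℝ] X => A v) (Ring.mul_inverse_cancel _ (hunit x)),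
    max C 0, le_max_right _ _, fun x => (hC x (mem_univ x)).trans (le_max_left _ _)⟩

variable {V : Type*} [NormedAddCommGroup V] [NormedSpace ℝ V] {k : ℝ → V →L[ℝ] V} {a b : ℝ}

lemma norm_truncConv_IccExtend_le (hk : Integrable k) (hab : a ≤ b) (ξ : Icc a b)
    (u : Icc a b →ᵇ V) (t : ℝ) :
    ‖truncConv k a ξ (IccExtend hab u) t‖ ≤ (∫ x, ‖k x‖) * ‖u‖ :=
  (norm_truncConv_le hk ξ.2.1 (norm_nonneg u) (fun _ _ => u.norm_coe_le_norm _) t).trans_eq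
    (mul_comm _ _)

/-- The truncated convolution as an operator on the continuous functions on `[a, b]`. -/
def truncConvCLM (hk : Integrable k) (hab : a ≤ b) (ξ : Icc a b) :
    (Icc a b →ᵇ V) →L[ℝ] (Icc a b →ᵇ V) :=
  LinearMap.mkContinuous
    { toFun := fun u => BoundedContinuousFunction.mkOfCompact
        ⟨fun t : Icc a b => truncConv k a ξ (IccExtend hab u) t,
          (continuous_truncConv hk ξ.2.1 u.continuous.Icc_extend').comp continuous_subtype_val⟩
      map_add' := fun u v => by
        ext1 t
        exact truncConv_add hk u.continuous.Icc_extend' v.continuous.Icc_extend'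
      map_smul' := fun c u => by
        ext1 t
        exact (intervalIntegral.integral_congr fun s _ => map_smul (k (t - s)) c _).trans
          (intervalIntegral.integral_smul c _) }
    (∫ x, ‖k x‖)
    fun u => (BoundedContinuousFunction.norm_le (by positivity)).2 fun t =>
      norm_truncConv_IccExtend_le hk hab ξ u t

lemma truncConvCLM_apply (hk : Integrable k) (hab : a ≤ b) (ξ t : Icc a b) (u : Icc a b →ᵇ V) :
    truncConvCLM hk hab ξ u t = truncConv k a ξ (IccExtend hab u) t := rfl

lemma isCompactOperator_truncConvCLM [FiniteDimensional ℝ V] (hk : Integrable k) (hab : a ≤ b)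
    (ξ : Icc a b) : IsCompactOperator (truncConvCLM hk hab ξ) := by
  have := FiniteDimensional.proper_real V
  refine (isCompactOperator_iff_isCompact_closure_image_closedBall
    (truncConvCLM hk hab ξ).toLinearMap one_pos).2 (BoundedContinuousFunction.arzela_ascoli
      (Metric.closedBall 0 (∫ x, ‖k x‖)) (isCompact_closedBall _ _) _ ?_ ?_)
  · rintro _ t ⟨u, hu, rfl⟩
    rw [mem_closedBall_zero_iff] at hu ⊢
    exact (norm_truncConv_IccExtend_le hk hab ξ u t).trans
      (mul_le_of_le_one_right (by positivity) hu)
  · refine fun t => Metric.equicontinuousAt_iff_right.2 fun ε hε => ?_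
    have hsub : Tendsto (fun t' : Icc a b => (t : ℝ) - t') (𝓝 t) (𝓝 0) := by
      have := (show Continuous fun t' : Icc a b => (t : ℝ) - t' by fun_prop).tendsto t
      rwa [sub_self] at this
    filter_upwards [((tendsto_integral_norm_translate_sub hk).comp hsub).eventually_lt_const hε]
      with t' ht'
    rintro ⟨_, u, hu, rfl⟩
    rw [mem_closedBall_zero_iff] at hu
    rw [dist_eq_norm]
    refine (norm_truncConv_sub_truncConv_le hk ξ.2.1 u.continuous.Icc_extend' zero_le_one
      (fun s _ => (u.norm_coe_le_norm _).trans hu) t t').trans_lt ?_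
    rwa [one_mul]

lemma norm_truncConvCLM_sub_le (hk : Integrable k) (hab : a ≤ b) {ξ η : Icc a b} (h : ξ ≤ η)
    {ε : ℝ} (hε : ∀ t, ∫ s in (ξ : ℝ)..η, ‖k (t - s)‖ ≤ ε) :
    ‖truncConvCLM hk hab η - truncConvCLM hk hab ξ‖ ≤ ε := by
  have hε0 : 0 ≤ ε :=
    (intervalIntegral.integral_nonneg h fun _ _ => norm_nonneg _).trans (hε 0)
  refine ContinuousLinearMap.opNorm_le_bound _ hε0 fun u =>
    (BoundedContinuousFunction.norm_le (by positivity)).2 fun t => ?_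
  change ‖truncConv k a η (IccExtend hab u) t - truncConv k a ξ (IccExtend hab u) t‖ ≤ _
  rw [truncConv_eq_add_integral hk u.continuous.Icc_extend' ξ η, add_sub_cancel_left, mul_comm]
  exact (norm_integral_kernel_apply_le hk h (fun _ _ => u.norm_coe_le_norm _) t).trans
    (mul_le_mul_of_nonneg_left (hε t) (norm_nonneg u))

lemma continuous_truncConvCLM (hk : Integrable k) (hab : a ≤ b) :
    Continuous (truncConvCLM hk hab) := by
  refine Metric.continuous_iff.2 fun ξ ε hε => ?_
  obtain ⟨δ, hδ, hsmall⟩ := exists_integral_norm_lt hk (half_pos hε)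
  refine ⟨δ, hδ, fun η hη => ?_⟩
  rw [Subtype.dist_eq, Real.dist_eq] at hη
  rcases le_total ξ η with h | h
  · rw [dist_eq_norm]
    exact (norm_truncConvCLM_sub_le hk hab h fun t =>
      (hsmall ξ η h ((le_abs_self _).trans_lt hη) t).le).trans_lt (half_lt_self hε)
  · rw [dist_comm, dist_eq_norm]
    rw [abs_sub_comm] at hη
    exact (norm_truncConvCLM_sub_le hk hab h fun t =>
      (hsmall η ξ h ((le_abs_self _).trans_lt hη) t).le).trans_lt (half_lt_self hε)

namespace InjectiveTruncations

lemma eqOn (hinj : InjectiveTruncations k a b) (hk : Integrable k) {ξ : ℝ} (hξ : ξ ∈ Icc a b)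
    {u v : ℝ → V} (hu : Continuous u) (hv : Continuous v)
    (huv : ∀ t ∈ Icc a ξ, u t + truncConv k a ξ u t = v t + truncConv k a ξ v t) :
    EqOn u v (Icc a ξ) := fun t ht =>
  sub_eq_zero.1 (hinj ξ hξ (fun s => u s - v s) (hu.sub hv) (fun s hs => by
    rw [truncConv_sub hk hu hv, sub_add_sub_comm, huv s hs, sub_self]) t ht)

lemma eq_zero_of_add_truncConvCLM (hinj : InjectiveTruncations k a b) (hk : Integrable k)
    (hab : a ≤ b) (ξ : Icc a b) (v : Icc a b →ᵇ V) (hv : v + truncConvCLM hk hab ξ v = 0) :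
    v = 0 := by
  have heq (t : Icc a b) : v t + truncConv k a ξ (IccExtend hab v) t = 0 := by
    rw [← truncConvCLM_apply hk]
    exact congrArg (fun u : Icc a b →ᵇ V => u t) hv
  have hz : EqOn (IccExtend hab v) (fun _ => 0) (Icc a ξ) :=
    hinj ξ ξ.2 _ v.continuous.Icc_extend' fun t ht => by
      rw [IccExtend_of_mem hab _ ⟨ht.1, ht.2.trans ξ.2.2⟩]
      exact heq ⟨t, ht.1, ht.2.trans ξ.2.2⟩
  ext1 t
  have ht := heq t
  rw [truncConv_congr ξ.2.1 hz] at ht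
  simpa [truncConv] using ht

theorem exists_isSolutionFamily [FiniteDimensional ℝ V] (hinj : InjectiveTruncations k a b)
    (hk : Integrable k) (hab : a ≤ b) :
    ∃ C, 0 ≤ C ∧ ∀ f : ℝ → V, Continuous f → ∃ φ, IsSolutionFamily k a b f φ ∧
      ∀ m, (∀ t ∈ Icc a b, ‖f t‖ ≤ m) → ∀ ξ t, ‖φ ξ t‖ ≤ C * m := by
  have := FiniteDimensional.complete ℝ V
  obtain ⟨R, hRc, hR, C, hC0, hRb⟩ := exists_continuous_inverse_one_add
    (continuous_truncConvCLM hk hab) (isCompactOperator_truncConvCLM hk hab)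
    (hinj.eq_zero_of_add_truncConvCLM hk hab)
  refine ⟨C, hC0, fun f hf => ?_⟩
  let f' : Icc a b →ᵇ V :=
    BoundedContinuousFunction.mkOfCompact ⟨fun t => f t, hf.comp continuous_subtype_val⟩
  refine ⟨fun ξ => IccExtend hab (R (projIcc a b hab ξ) f'), ⟨?_, fun ξ hξ t ht => ?_⟩,
    fun m hm ξ t => ?_⟩
  · exact ((hRc.comp (continuous_projIcc.comp continuous_fst)).clm_apply continuous_const).eval
      (continuous_projIcc.comp continuous_snd)
  · rw [projIcc_of_mem hab hξ, IccExtend_of_mem hab _ ht]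
    exact congrArg (fun u : Icc a b →ᵇ V => u ⟨t, ht⟩) (hR ⟨ξ, hξ⟩ f')
  · have hm0 : 0 ≤ m := (norm_nonneg _).trans (hm a ⟨le_rfl, hab⟩)
    have hf' : ‖f'‖ ≤ m := (BoundedContinuousFunction.norm_le hm0).2 fun t => hm t t.2
    exact (BoundedContinuousFunction.norm_coe_le_norm _ _).trans
      (((R _).le_of_opNorm_le (hRb _) f').trans (mul_le_mul_of_nonneg_left hf' hC0))

end InjectiveTruncations

end Fredholm

section Duality

variable {V W U : Type*} [NormedAddCommGroup V] [NormedSpace ℝ V] [NormedAddCommGroup W]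
  [NormedSpace ℝ W] [NormedAddCommGroup U] [NormedSpace ℝ U] {k : ℝ → V →L[ℝ] V}
  {l : ℝ → W →L[ℝ] W} {B : W →L[ℝ] V →L[ℝ] U} {a b ξ η : ℝ} {χ : ℝ → W} {u : ℝ → V}

lemma integrable_pairing_kernel (hk : Integrable k) (hχ : Continuous χ) (hu : Continuous u)
    (a ξ c η : ℝ) :
    Integrable (fun z : ℝ × ℝ => B (χ z.1) (k (z.1 - z.2) (u z.2)))
      ((volume.restrict (Ioc a ξ)).prod (volume.restrict (Ioc c η))) := by
  have hu' : Integrable u (volume.restrict (Ioc c η)) := hu.integrableOn_Ioc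
  have hku : Integrable (fun z : ℝ × ℝ => k (z.1 - z.2) (u z.2))
      ((volume.restrict (Ioc a ξ)).prod (volume.restrict (Ioc c η))) :=
    (hu'.convolution_integrand (ContinuousLinearMap.apply ℝ V) hk).mono_measure
      (Measure.prod_mono Measure.restrict_le_self le_rfl)
  obtain ⟨m, hm⟩ := isCompact_Icc.exists_bound_of_continuousOn (hχ.continuousOn (s := Icc a ξ))
  have hχ' : MemLp (fun z : ℝ × ℝ => χ z.1) ⊤
      ((volume.restrict (Ioc a ξ)).prod (volume.restrict (Ioc c η))) := by
    refine memLp_top_of_bound (hχ.comp continuous_fst).aestronglyMeasurable m ?_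
    rw [Measure.prod_restrict]
    exact ae_restrict_of_forall_mem (measurableSet_Ioc.prod measurableSet_Ioc) fun z hz =>
      hm _ (Ioc_subset_Icc_self hz.1)
  exact memLp_one_iff_integrable.1 (B.memLp_of_bilin 1 hχ' (memLp_one_iff_integrable.2 hku))

variable [CompleteSpace U]

lemma eq_zero_of_forall_integral_pairing_eq_zero (hsep : ∀ w, (∀ v, B w v = 0) → w = 0)
    (hχ : Continuous χ) (haξ : a < ξ)
    (h : ∀ f : ℝ → V, Continuous f → ∫ t in a..ξ, B (χ t) (f t) = 0) {t : ℝ}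
    (ht : t ∈ Icc a ξ) : χ t = 0 := by
  refine hsep _ fun v => SeparatingDual.eq_zero_of_forall_dual_eq_zero (R := ℝ) fun ℓ => ?_
  have hf : Continuous fun s => ℓ (B (χ s) v) • v := by fun_prop
  have hsq : ∫ s in a..ξ, ℓ (B (χ s) v) ^ 2 = 0 := by
    rw [← map_zero ℓ, ← h _ hf,
      ← ℓ.intervalIntegral_comp_comm (Continuous.intervalIntegrable (by fun_prop) _ _)]
    simp only [map_smul, smul_eq_mul, sq]
  by_contra hne
  refine (intervalIntegral.integral_pos haξ (Continuous.continuousOn (by fun_prop))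
    (fun s _ => sq_nonneg (ℓ (B (χ s) v))) ⟨t, ht, ?_⟩).ne' hsq
  exact sq_pos_of_ne_zero hne

variable [CompleteSpace V] [CompleteSpace W]

lemma integral_pairing_truncConv (hB : ∀ x w v, B (l x w) v = B w (k (-x) v)) (hk : Integrable k)
    (hl : Integrable l) (hξ : a ≤ ξ) (hη : a ≤ η) (hχ : Continuous χ) (hu : Continuous u) :
    ∫ t in a..ξ, B (χ t) (truncConv k a η u t) =
      ∫ s in a..η, B (truncConv l a ξ χ s) (u s) := by
  have hleft (t : ℝ) : B (χ t) (truncConv k a η u t) =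
      ∫ s in Ioc a η, B (χ t) (k (t - s) (u s)) := by
    rw [clm_truncConv (B (χ t)) hk hu, intervalIntegral.integral_of_le hη]
  have hright (s : ℝ) : B (truncConv l a ξ χ s) (u s) =
      ∫ t in Ioc a ξ, B (χ t) (k (t - s) (u s)) := by
    rw [← B.flip_apply, clm_truncConv (B.flip (u s)) hl hχ, intervalIntegral.integral_of_le hξ]
    simp only [B.flip_apply, hB, neg_sub]
  simp only [hleft, hright, intervalIntegral.integral_of_le hξ, intervalIntegral.integral_of_le hη]
  exact integral_integral_swap (integrable_pairing_kernel hk hχ hu a ξ a η)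

lemma integral_pairing_add_truncConv (hB : ∀ x w v, B (l x w) v = B w (k (-x) v))
    (hk : Integrable k) (hl : Integrable l) (hξ : a ≤ ξ) (hχ : Continuous χ) (hu : Continuous u) :
    ∫ t in a..ξ, B (χ t) (u t + truncConv k a ξ u t) =
      ∫ t in a..ξ, B (χ t + truncConv l a ξ χ t) (u t) := by
  have hku := continuous_truncConv hk hξ hu
  have hlχ := continuous_truncConv hl hξ hχ
  simp only [map_add, add_apply]
  rw [intervalIntegral.integral_add (Continuous.intervalIntegrable (by fun_prop) _ _)
      (Continuous.intervalIntegrable (by fun_prop) _ _),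
    intervalIntegral.integral_add (Continuous.intervalIntegrable (by fun_prop) _ _)
      (Continuous.intervalIntegrable (by fun_prop) _ _),
    integral_pairing_truncConv hB hk hl hξ hξ hχ hu]

lemma InjectiveTruncations.dual [FiniteDimensional ℝ V] (hinj : InjectiveTruncations k a b)
    (hB : ∀ x w v, B (l x w) v = B w (k (-x) v)) (hsep : ∀ w, (∀ v, B w v = 0) → w = 0)
    (hk : Integrable k) (hl : Integrable l) : InjectiveTruncations l a b := by
  intro ξ hξ χ hχ hχ0
  rcases hξ.1.eq_or_lt with rfl | haξ
  · simpa [truncConv] using hχ0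
  obtain ⟨_, -, hsol⟩ := hinj.exists_isSolutionFamily hk (hξ.1.trans hξ.2)
  refine fun t ht => eq_zero_of_forall_integral_pairing_eq_zero hsep hχ haξ (fun f hf => ?_) ht
  obtain ⟨φ, hφ, -⟩ := hsol f hf
  have hφξ : Continuous (φ ξ) := hφ.continuous.comp (Continuous.prodMk_right ξ)
  calc ∫ t in a..ξ, B (χ t) (f t) = ∫ t in a..ξ, B (χ t) (φ ξ t + truncConv k a ξ (φ ξ) t) :=
        intervalIntegral.integral_congr fun s hs => by
          rw [uIcc_of_le hξ.1] at hs
          simp only [hφ.eq ξ hξ s ⟨hs.1, hs.2.trans hξ.2⟩]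
    _ = ∫ t in a..ξ, B (χ t + truncConv l a ξ χ t) (φ ξ t) :=
        integral_pairing_add_truncConv hB hk hl hξ.1 hχ hφξ
    _ = 0 := intervalIntegral.integral_zero_ae <| ae_of_all _ fun s hs => by
        rw [uIoc_of_le hξ.1] at hs
        rw [hχ0 s (Ioc_subset_Icc_self hs), map_zero, zero_apply]

end Duality

lemma abs_le_sq_div_add {e : ℝ} (he : 0 < e) (y : ℝ) : |y| ≤ y / (|y| + e) * y + e := by
  have hy : 0 < |y| + e := by positivity
  rw [div_mul_eq_mul_div, ← abs_mul_abs_self, ← sub_le_iff_le_add, le_div_iff₀ hy]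
  nlinarith

section MeanBound

set_option maxSynthPendingDepth 3

variable {V : Type*} [NormedAddCommGroup V] [NormedSpace ℝ V] {k : ℝ → V →L[ℝ] V} {a b : ℝ}

/-- The kernel `x ↦ k(-x)*` acting on the dual space, whose truncated convolutions are the
transposes of those of `k`. -/
def dualKernel (k : ℝ → V →L[ℝ] V) (x : ℝ) : (V →L[ℝ] ℝ) →L[ℝ] V →L[ℝ] ℝ :=
  (ContinuousLinearMap.compL ℝ V V ℝ).flip (k (-x))

lemma integrable_dualKernel (hk : Integrable k) : Integrable (dualKernel k) :=
  (ContinuousLinearMap.compL ℝ V V ℝ).flip.integrable_comp hk.comp_neg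

variable [FiniteDimensional ℝ V]

lemma exists_norm_integral_dual_apply_le (hinj : InjectiveTruncations k a b) (hk : Integrable k)
    (hab : a ≤ b) :
    ∃ C, 0 ≤ C ∧ ∀ ξ ∈ Icc a b, ∀ u : ℝ → V, Continuous u → ∀ ψ : ℝ → V →L[ℝ] ℝ,
      Continuous ψ → ∀ m, (∀ t, ‖ψ t‖ ≤ m) →
        ‖∫ t in a..ξ, ψ t (u t)‖ ≤ C * m * ∫ t in a..ξ, ‖u t + truncConv k a ξ u t‖ := by
  have := FiniteDimensional.complete ℝ V
  let B := ContinuousLinearMap.id ℝ (V →L[ℝ] ℝ)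
  have hl := integrable_dualKernel hk
  have hB (x : ℝ) (w : V →L[ℝ] ℝ) (v : V) : B (dualKernel k x w) v = B w (k (-x) v) := rfl
  obtain ⟨C, hC0, hC⟩ := (hinj.dual hB (fun w hw => ContinuousLinearMap.ext hw) hk
    hl).exists_isSolutionFamily hl hab
  refine ⟨C, hC0, fun ξ hξ u hu ψ hψ m hm => ?_⟩
  obtain ⟨χ, hχ, hχm⟩ := hC ψ hψ
  have hχξ : Continuous (χ ξ) := hχ.continuous.comp (Continuous.prodMk_right ξ)
  have hr : Continuous fun t => u t + truncConv k a ξ u t :=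
    hu.add (continuous_truncConv hk hξ.1 hu)
  have hswap : ∫ t in a..ξ, ψ t (u t) = ∫ t in a..ξ, χ ξ t (u t + truncConv k a ξ u t) := by
    refine Eq.trans (intervalIntegral.integral_congr fun s hs => ?_)
      (integral_pairing_add_truncConv hB hk hl hξ.1 hχξ hu).symm
    rw [uIcc_of_le hξ.1] at hs
    simp only [hχ.eq ξ hξ s ⟨hs.1, hs.2.trans hξ.2⟩, B, ContinuousLinearMap.id_apply]
  rw [hswap, ← intervalIntegral.integral_const_mul]
  exact intervalIntegral.norm_integral_le_of_norm_le hξ.1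
    (ae_of_all _ fun t _ => (χ ξ t).le_of_opNorm_le (hχm m (fun t _ => hm t) ξ t) _)
    ((hr.norm.const_smul (C * m)).intervalIntegrable _ _)

/-- The functional `ℓ` is tested against `u` through the regularized sign
`t ↦ ℓ (u t) / (|ℓ (u t)| + e)`. -/
lemma exists_integral_abs_dual_apply_le (hinj : InjectiveTruncations k a b) (hk : Integrable k)
    (hab : a ≤ b) :
    ∃ C, 0 ≤ C ∧ ∀ ξ ∈ Icc a b, ∀ u : ℝ → V, Continuous u → ∀ ℓ : V →L[ℝ] ℝ,
      ∫ t in a..ξ, |ℓ (u t)| ≤ C * ‖ℓ‖ * ∫ t in a..ξ, ‖u t + truncConv k a ξ u t‖ := by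
  obtain ⟨C, hC0, hC⟩ := exists_norm_integral_dual_apply_le hinj hk hab
  refine ⟨C, hC0, fun ξ hξ u hu ℓ => ?_⟩
  have hsign (e : ℝ) (he : 0 < e) : ∫ t in a..ξ, |ℓ (u t)| ≤
      (C * ‖ℓ‖ * ∫ t in a..ξ, ‖u t + truncConv k a ξ u t‖) + (ξ - a) * e := by
    have hden (t : ℝ) : |ℓ (u t)| + e ≠ 0 := by positivity
    have hσ : Continuous fun t => ℓ (u t) / (|ℓ (u t)| + e) := by fun_prop (disch := assumption)
    have hσℓ (t : ℝ) : ‖(ℓ (u t) / (|ℓ (u t)| + e)) • ℓ‖ ≤ ‖ℓ‖ := by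
      rw [norm_smul, norm_div, Real.norm_eq_abs, Real.norm_of_nonneg (by positivity)]
      exact mul_le_of_le_one_left (norm_nonneg _) (div_le_one_of_le₀ (by linarith) (by positivity))
    calc ∫ t in a..ξ, |ℓ (u t)|
        ≤ ∫ t in a..ξ, (ℓ (u t) / (|ℓ (u t)| + e) * ℓ (u t) + e) :=
          intervalIntegral.integral_mono_on hξ.1 (Continuous.intervalIntegrable (by fun_prop) _ _)
            (Continuous.intervalIntegrable (by fun_prop) _ _) fun t _ => abs_le_sq_div_add he _
      _ = (∫ t in a..ξ, ((ℓ (u t) / (|ℓ (u t)| + e)) • ℓ) (u t)) + (ξ - a) * e := by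
          rw [intervalIntegral.integral_add (Continuous.intervalIntegrable (by fun_prop) _ _)
            intervalIntegrable_const, intervalIntegral.integral_const]
          rfl
      _ ≤ _ := add_le_add_left ((Real.le_norm_self _).trans
          (hC ξ hξ u hu _ (hσ.smul continuous_const) _ hσℓ)) _
  have hlim : Tendsto (fun e => (C * ‖ℓ‖ * ∫ t in a..ξ, ‖u t + truncConv k a ξ u t‖) +
      (ξ - a) * e) (𝓝[>] 0) (𝓝 (C * ‖ℓ‖ * ∫ t in a..ξ, ‖u t + truncConv k a ξ u t‖)) := by
    refine tendsto_nhdsWithin_of_tendsto_nhds ?_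
    simpa using (tendsto_id (x := 𝓝 (0 : ℝ))).const_mul (ξ - a) |>.const_add
      (C * ‖ℓ‖ * ∫ t in a..ξ, ‖u t + truncConv k a ξ u t‖)
  exact ge_of_tendsto hlim (eventually_mem_nhdsWithin.mono hsign)

theorem InjectiveTruncations.exists_integral_norm_le (hinj : InjectiveTruncations k a b)
    (hk : Integrable k) (hab : a ≤ b) :
    ∃ C, 0 ≤ C ∧ ∀ ξ ∈ Icc a b, ∀ u : ℝ → V, Continuous u →
      ∫ t in a..ξ, ‖u t‖ ≤ C * ∫ t in a..ξ, ‖u t + truncConv k a ξ u t‖ := by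
  obtain ⟨C, hC0, hC⟩ := exists_integral_abs_dual_apply_le hinj hk hab
  let e := Module.finBasis ℝ V
  let ℓ (i) : V →L[ℝ] ℝ := (e.coord i).toContinuousLinearMap
  refine ⟨∑ i, ‖e i‖ * (C * ‖ℓ i‖), by positivity, fun ξ hξ u hu => ?_⟩
  have hnorm (v : V) : ‖v‖ ≤ ∑ i, ‖e i‖ * |ℓ i v| :=
    calc ‖v‖ = ‖∑ i, ℓ i v • e i‖ := congrArg norm (e.sum_repr v).symm
      _ ≤ ∑ i, ‖e i‖ * |ℓ i v| := (norm_sum_le _ _).trans_eq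
          (Finset.sum_congr rfl fun i _ => by rw [norm_smul, mul_comm, Real.norm_eq_abs])
  calc ∫ t in a..ξ, ‖u t‖ ≤ ∫ t in a..ξ, ∑ i, ‖e i‖ * |ℓ i (u t)| :=
        intervalIntegral.integral_mono_on hξ.1 (hu.norm.intervalIntegrable _ _)
          (Continuous.intervalIntegrable (by fun_prop) _ _) fun t _ => hnorm (u t)
    _ = ∑ i, ‖e i‖ * ∫ t in a..ξ, |ℓ i (u t)| := by
        rw [intervalIntegral.integral_finsetSum fun i _ =>
          Continuous.intervalIntegrable (by fun_prop) _ _]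
        simp only [intervalIntegral.integral_const_mul]
    _ ≤ ∑ i, ‖e i‖ * (C * ‖ℓ i‖ * ∫ t in a..ξ, ‖u t + truncConv k a ξ u t‖) :=
        Finset.sum_le_sum fun i _ => mul_le_mul_of_nonneg_left (hC ξ hξ u hu (ℓ i)) (norm_nonneg _)
    _ = _ := by simp only [Finset.sum_mul, mul_assoc]

end MeanBound

section ActiveSum

/-- The sum of those `h i` whose interval of definition `[a, α i]` contains the point `s`. -/
def activeSum (I : Finset ℕ) (α : ℕ → ℝ) (h : ℕ → ℝ → ℝ) (s : ℝ) : ℝ :=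
  ∑ i ∈ I with s ≤ α i, h i s

variable {I : Finset ℕ} {α : ℕ → ℝ} {h h' : ℕ → ℝ → ℝ} {a b s : ℝ}

lemma activeSum_le_activeSum (hh : ∀ i ∈ I, s ≤ α i → h i s ≤ h' i s) :
    activeSum I α h s ≤ activeSum I α h' s :=
  Finset.sum_le_sum fun i hi => hh i (Finset.mem_filter.1 hi).1 (Finset.mem_filter.1 hi).2

lemma activeSum_le_sum (hh : ∀ i ∈ I, 0 ≤ h i s) : activeSum I α h s ≤ ∑ i ∈ I, h i s :=
  Finset.sum_le_sum_of_subset_of_nonneg (Finset.filter_subset _ _) fun i hi _ => hh i hi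

lemma activeSum_eq_sum_indicator :
    activeSum I α h = fun s => ∑ i ∈ I, (Iic (α i)).indicator (h i) s := by
  ext s
  simp only [activeSum, Finset.sum_filter, indicator_apply, mem_Iic]

lemma intervalIntegrable_indicator_Iic {f : ℝ → ℝ} {c : ℝ} (hc : c ∈ Icc a b)
    (hf : IntervalIntegrable f volume a c) :
    IntervalIntegrable ((Iic c).indicator f) volume a b := by
  rw [intervalIntegrable_iff_integrableOn_Ioc_of_le hc.1] at hf
  rw [intervalIntegrable_iff_integrableOn_Ioc_of_le (hc.1.trans hc.2), IntegrableOn,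
    integrable_indicator_iff measurableSet_Iic, IntegrableOn,
    Measure.restrict_restrict measurableSet_Iic, inter_comm, Ioc_inter_Iic, min_eq_right hc.2]
  exact hf

lemma integral_indicator_Iic {f : ℝ → ℝ} {c : ℝ} (hc : c ∈ Icc a b) :
    ∫ s in a..b, (Iic c).indicator f s = ∫ s in a..c, f s := by
  rw [intervalIntegral.integral_of_le (hc.1.trans hc.2), intervalIntegral.integral_of_le hc.1,
    integral_indicator measurableSet_Iic, Measure.restrict_restrict measurableSet_Iic, inter_comm,
    Ioc_inter_Iic, min_eq_right hc.2]

lemma intervalIntegrable_activeSum (hα : ∀ i ∈ I, α i ∈ Icc a b)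
    (hh : ∀ i ∈ I, IntervalIntegrable (h i) volume a (α i)) :
    IntervalIntegrable (activeSum I α h) volume a b := by
  rw [activeSum_eq_sum_indicator]
  simpa only [Finset.sum_fn] using
    IntervalIntegrable.sum I fun i hi => intervalIntegrable_indicator_Iic (hα i hi) (hh i hi)

lemma sum_integral_eq_integral_activeSum (hα : ∀ i ∈ I, α i ∈ Icc a b)
    (hh : ∀ i ∈ I, IntervalIntegrable (h i) volume a (α i)) :
    ∑ i ∈ I, ∫ s in a..α i, h i s = ∫ s in a..b, activeSum I α h s := by
  rw [activeSum_eq_sum_indicator, intervalIntegral.integral_finsetSum fun i hi =>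
    intervalIntegrable_indicator_Iic (hα i hi) (hh i hi)]
  exact Finset.sum_congr rfl fun i hi => (integral_indicator_Iic (hα i hi)).symm

end ActiveSum

lemma le_two_mul_of_forall_le_add_half {X : Type*} {q : X → ℝ} {A : ℝ} (hq : BddAbove (range q))
    (h : ∀ B, (∀ x, q x ≤ B) → ∀ x, q x ≤ A + B / 2) (x : X) : q x ≤ 2 * A := by
  have hsup := h _ fun x => le_ciSup hq x
  have : Nonempty X := ⟨x⟩
  linarith [ciSup_le hsup, hsup x]

lemma exists_integral_excess_le {E : Type*} [NormedAddCommGroup E] {f : ℝ → E} (hf : Integrable f)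
    {ε : ℝ} (hε : 0 < ε) : ∃ p, 0 ≤ p ∧ ∫ x, max (‖f x‖ - p) 0 ≤ ε := by
  have hlim : Tendsto (fun p : ℕ => ∫ x, max (‖f x‖ - p) 0) atTop (𝓝 (∫ _ : ℝ, (0 : ℝ))) := by
    refine tendsto_integral_of_dominated_convergence (fun x => ‖f x‖)
      (fun p => ((hf.norm.aestronglyMeasurable.sub aestronglyMeasurable_const).sup
        aestronglyMeasurable_const)) hf.norm (fun p => ae_of_all _ fun x => ?_)
      (ae_of_all _ fun x => ?_)
    · rw [Real.norm_of_nonneg (le_max_right _ _)]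
      exact max_le (sub_le_self _ p.cast_nonneg) (norm_nonneg _)
    · obtain ⟨p₀, hp₀⟩ := exists_nat_ge ‖f x‖
      refine tendsto_const_nhds.congr' ((eventually_ge_atTop p₀).mono fun p hp => ?_)
      exact (max_eq_right (sub_nonpos.2 (hp₀.trans (Nat.cast_le.2 hp)))).symm
  rw [integral_zero] at hlim
  obtain ⟨p, hp⟩ := (hlim.eventually_lt_const hε).exists
  exact ⟨p, p.cast_nonneg, hp.le⟩

section SummedBounds

variable {V : Type*} [NormedAddCommGroup V] [NormedSpace ℝ V] {k : ℝ → V →L[ℝ] V} {a b : ℝ}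

lemma activeSum_norm_le_add_integral (hk : Integrable k) {I : Finset ℕ} {α : ℕ → ℝ}
    (hα : ∀ i ∈ I, α i ∈ Icc a b) {u : ℕ → ℝ → V} (hu : ∀ i ∈ I, Continuous (u i)) (t : ℝ) :
    activeSum I α (fun i s => ‖u i s‖) t ≤
      activeSum I α (fun i s => ‖u i s + truncConv k a (α i) (u i) s‖) t +
        ∫ s in a..b, ‖k (t - s)‖ * activeSum I α (fun i s => ‖u i s‖) s := by
  have hku (i) (hi : i ∈ I) (c : ℝ) :
      IntervalIntegrable (fun s => ‖k (t - s)‖ * ‖u i s‖) volume a c :=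
    (intervalIntegrable_norm_comp_sub hk t a c).mul_continuousOn (hu i hi).norm.continuousOn
  calc activeSum I α (fun i s => ‖u i s‖) t
      ≤ activeSum I α (fun i s => ‖u i s + truncConv k a (α i) (u i) s‖) t +
          activeSum I α (fun i s => ‖truncConv k a (α i) (u i) s‖) t := by
        simp only [activeSum, ← Finset.sum_add_distrib]
        exact Finset.sum_le_sum fun i _ => norm_le_add_norm_add _ _
    _ ≤ activeSum I α (fun i s => ‖u i s + truncConv k a (α i) (u i) s‖) t +
          ∑ i ∈ I, ∫ s in a..α i, ‖k (t - s)‖ * ‖u i s‖ := by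
        refine add_le_add_right ((activeSum_le_sum (h := fun i s => ‖truncConv k a (α i) (u i) s‖)
          fun i _ => norm_nonneg _).trans (Finset.sum_le_sum fun i hi => ?_)) _
        exact intervalIntegral.norm_integral_le_of_norm_le (hα i hi).1
          (ae_of_all _ fun s _ => (k (t - s)).le_opNorm _) (hku i hi _)
    _ = _ := by
        rw [sum_integral_eq_integral_activeSum hα fun i hi => hku i hi _]
        simp only [activeSum, Finset.mul_sum]

lemma integral_norm_kernel_mul_le (hk : Integrable k) (hab : a ≤ b) {p m : ℝ} {N : ℝ → ℝ}
    (hN : IntervalIntegrable N volume a b) (hN0 : ∀ s, 0 ≤ N s) (hNm : ∀ s ∈ Icc a b, N s ≤ m)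
    (hp : 0 ≤ p) (t : ℝ) :
    ∫ s in a..b, ‖k (t - s)‖ * N s ≤
      p * (∫ s in a..b, N s) + m * ∫ x, max (‖k x‖ - p) 0 := by
  have hm : 0 ≤ m := (hN0 a).trans (hNm a ⟨le_rfl, hab⟩)
  have hexc : Integrable fun x => max (‖k x‖ - p) 0 :=
    hk.norm.mono' ((hk.norm.aestronglyMeasurable.sub aestronglyMeasurable_const).sup
      aestronglyMeasurable_const) (ae_of_all _ fun x => by
        rw [Real.norm_of_nonneg (le_max_right _ _)]
        exact max_le (sub_le_self _ hp) (norm_nonneg _))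
  have hint : IntervalIntegrable (fun s => p * N s + m * ‖max (‖k (t - s)‖ - p) 0‖) volume a b :=
    (hN.const_mul p).add ((intervalIntegrable_norm_comp_sub hexc t a b).const_mul m)
  calc ∫ s in a..b, ‖k (t - s)‖ * N s
      ≤ ∫ s in a..b, (p * N s + m * ‖max (‖k (t - s)‖ - p) 0‖) := by
        rw [intervalIntegral.integral_of_le hab, intervalIntegral.integral_of_le hab]
        refine integral_mono_of_nonneg (ae_of_all _ fun s => mul_nonneg (norm_nonneg _) (hN0 s))
          hint.1 (ae_restrict_of_forall_mem measurableSet_Ioc fun s hs => ?_)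
        simp only [Real.norm_of_nonneg (le_max_right (‖k (t - s)‖ - p) 0)]
        calc ‖k (t - s)‖ * N s ≤ (p + max (‖k (t - s)‖ - p) 0) * N s :=
              mul_le_mul_of_nonneg_right (sub_le_iff_le_add'.1 (le_max_left _ _)) (hN0 s)
          _ ≤ p * N s + m * max (‖k (t - s)‖ - p) 0 := by
              rw [add_mul, mul_comm m]
              exact add_le_add_right (mul_le_mul_of_nonneg_left (hNm s (Ioc_subset_Icc_self hs))
                (le_max_right _ _)) _
    _ = p * (∫ s in a..b, N s) + m * ∫ s in a..b, ‖max (‖k (t - s)‖ - p) 0‖ := by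
        rw [intervalIntegral.integral_add (hN.const_mul p)
          ((intervalIntegrable_norm_comp_sub hexc t a b).const_mul m),
          intervalIntegral.integral_const_mul, intervalIntegral.integral_const_mul]
    _ ≤ _ := by
        refine add_le_add_right (mul_le_mul_of_nonneg_left ?_ hm) _
        exact (integral_norm_comp_sub_le hexc hab t).trans_eq
          (integral_congr_ae (ae_of_all _ fun x => Real.norm_of_nonneg (le_max_right _ _)))

variable [FiniteDimensional ℝ V]

lemma InjectiveTruncations.exists_integral_activeSum_norm_le (hinj : InjectiveTruncations k a b)
    (hk : Integrable k) (hab : a ≤ b) :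
    ∃ C, 0 ≤ C ∧ ∀ (I : Finset ℕ) (α : ℕ → ℝ), (∀ i ∈ I, α i ∈ Icc a b) →
      ∀ u : ℕ → ℝ → V, (∀ i ∈ I, Continuous (u i)) → ∀ m, (∀ s ∈ Icc a b,
        activeSum I α (fun i s => ‖u i s + truncConv k a (α i) (u i) s‖) s ≤ m) →
      ∫ s in a..b, activeSum I α (fun i s => ‖u i s‖) s ≤ C * m := by
  obtain ⟨C, hC0, hC⟩ := hinj.exists_integral_norm_le hk hab
  refine ⟨C * (b - a), mul_nonneg hC0 (sub_nonneg.2 hab), fun I α hα u hu m hm => ?_⟩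
  have hr (i) (hi : i ∈ I) :
      IntervalIntegrable (fun s => ‖u i s + truncConv k a (α i) (u i) s‖) volume a (α i) :=
    ((hu i hi).add (continuous_truncConv hk (hα i hi).1 (hu i hi))).norm.intervalIntegrable _ _
  calc ∫ s in a..b, activeSum I α (fun i s => ‖u i s‖) s
      = ∑ i ∈ I, ∫ s in a..α i, ‖u i s‖ := (sum_integral_eq_integral_activeSum hα fun i hi =>
          (hu i hi).norm.intervalIntegrable _ _).symm
    _ ≤ C * ∑ i ∈ I, ∫ s in a..α i, ‖u i s + truncConv k a (α i) (u i) s‖ := by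
        rw [Finset.mul_sum]
        exact Finset.sum_le_sum fun i hi => hC (α i) (hα i hi) (u i) (hu i hi)
    _ ≤ C * ∫ _ in a..b, m := by
        rw [sum_integral_eq_integral_activeSum hα hr]
        exact mul_le_mul_of_nonneg_left (intervalIntegral.integral_mono_on hab
          (intervalIntegrable_activeSum hα hr) intervalIntegrable_const hm) hC0
    _ = C * (b - a) * m := by rw [intervalIntegral.integral_const, smul_eq_mul, mul_assoc]

/-- With a single summand this is the a priori estimate in the uniform norm. In general the mean of
the sum is under control; the bounded part of the kernel turns this into uniform control, and the
integrable remainder is absorbed. -/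
theorem InjectiveTruncations.exists_activeSum_norm_le (hinj : InjectiveTruncations k a b)
    (hk : Integrable k) (hab : a ≤ b) :
    ∃ C, 0 ≤ C ∧ ∀ (I : Finset ℕ) (α : ℕ → ℝ), (∀ i ∈ I, α i ∈ Icc a b) →
      ∀ u : ℕ → ℝ → V, (∀ i ∈ I, Continuous (u i)) → ∀ m, (∀ s ∈ Icc a b,
        activeSum I α (fun i s => ‖u i s + truncConv k a (α i) (u i) s‖) s ≤ m) →
      ∀ t ∈ Icc a b, activeSum I α (fun i s => ‖u i s‖) t ≤ C * m := by
  obtain ⟨C, hC0, hC⟩ := hinj.exists_integral_activeSum_norm_le hk hab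
  obtain ⟨p, hp0, hp⟩ := exists_integral_excess_le hk one_half_pos
  refine ⟨2 * (1 + p * C), by positivity, fun I α hα u hu m hm t ht => ?_⟩
  set N := activeSum I α fun i s => ‖u i s‖
  have hN0 (s : ℝ) : 0 ≤ N s := Finset.sum_nonneg fun i _ => norm_nonneg _
  have hNint : IntervalIntegrable N volume a b :=
    intervalIntegrable_activeSum hα fun i hi => (hu i hi).norm.intervalIntegrable _ _
  have hstep (B : ℝ) (hB : ∀ s ∈ Icc a b, N s ≤ B) (s : ℝ) (hs : s ∈ Icc a b) :
      N s ≤ (1 + p * C) * m + B / 2 := by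
    have hB0 : 0 ≤ B := (hN0 a).trans (hB a ⟨le_rfl, hab⟩)
    calc N s ≤ m + ∫ r in a..b, ‖k (s - r)‖ * N r :=
          (activeSum_norm_le_add_integral hk hα hu s).trans (add_le_add_left (hm s hs) _)
      _ ≤ m + (p * (C * m) + B * (1 / 2)) := by
          refine add_le_add_right
            ((integral_norm_kernel_mul_le hk hab hNint hN0 hB hp0 s).trans ?_) _
          gcongr
          exact hC I α hα u hu m hm
      _ = _ := by ring
  have hbdd : BddAbove (range fun s : Icc a b => N s) := by
    obtain ⟨c, hc⟩ := isCompact_Icc.exists_bound_of_continuousOn (s := Icc a b)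
      (continuous_finsetSum I fun i hi => (hu i hi).norm).continuousOn
    refine ⟨c, ?_⟩
    rintro _ ⟨s, rfl⟩
    exact (activeSum_le_sum (h := fun i s => ‖u i s‖) fun i _ => norm_nonneg _).trans
      ((Real.le_norm_self _).trans (hc s s.2))
  rw [mul_assoc]
  exact le_two_mul_of_forall_le_add_half hbdd
    (fun B hB s => hstep B (fun s hs => hB ⟨s, hs⟩) s s.2) ⟨t, ht⟩

theorem InjectiveTruncations.exists_activeSum_norm_sub_le (hinj : InjectiveTruncations k a b)
    (hk : Integrable k) (hab : a ≤ b) :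
    ∃ C, 0 ≤ C ∧ ∀ (I : Finset ℕ) (α β : ℕ → ℝ),
      (∀ i ∈ I, a ≤ α i ∧ α i ≤ β i ∧ β i ≤ b) → ∀ v w f g : ℕ → ℝ → V,
      (∀ i ∈ I, Continuous (v i)) → (∀ i ∈ I, Continuous (w i)) →
      (∀ i ∈ I, ∀ t ∈ Icc a (α i), v i t + truncConv k a (β i) (v i) t = f i t) →
      (∀ i ∈ I, ∀ t ∈ Icc a (α i), w i t + truncConv k a (α i) (w i) t = g i t) →
      ∀ m, (∀ i ∈ I, ∀ s ∈ Icc (α i) (β i), ‖v i s‖ ≤ m) → ∀ e, (∀ t ∈ Icc a b,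
        activeSum I α (fun i t => ‖f i t - g i t‖ + m * ∫ s in α i..β i, ‖k (t - s)‖) t ≤ e) →
      ∀ t ∈ Icc a b, activeSum I α (fun i t => ‖v i t - w i t‖) t ≤ C * e := by
  obtain ⟨C, hC0, hC⟩ := hinj.exists_activeSum_norm_le hk hab
  refine ⟨C, hC0, fun I α β hαβ v w f g hv hw hvf hwg m hm e he => hC I α
    (fun i hi => ⟨(hαβ i hi).1, (hαβ i hi).2.1.trans (hαβ i hi).2.2⟩) (fun i t => v i t - w i t)
    (fun i hi => (hv i hi).sub (hw i hi)) e fun t ht => le_trans ?_ (he t ht)⟩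
  refine activeSum_le_activeSum fun i hi hti => ?_
  have hinc : v i t - w i t + truncConv k a (α i) (fun s => v i s - w i s) t =
      f i t - g i t - ∫ s in α i..β i, k (t - s) (v i s) := by
    rw [truncConv_sub hk (hv i hi) (hw i hi), ← hvf i hi t ⟨ht.1, hti⟩, ← hwg i hi t ⟨ht.1, hti⟩,
      truncConv_eq_add_integral hk (hv i hi) (α i) (β i)]
    abel
  rw [hinc]
  exact (norm_sub_le _ _).trans (add_le_add_right
    (norm_integral_kernel_apply_le hk (hαβ i hi).2.1 (hm i hi) t) _)

end SummedBounds

section Diagonal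

variable {V : Type*} [NormedAddCommGroup V] [NormedSpace ℝ V] {k : ℝ → V →L[ℝ] V} {a b ξ t : ℝ}
  {u : ℝ → V}

lemma truncConv_reflect (heven : ∀ x, k (-x) = k x) :
    truncConv k a ξ (fun s => u (ξ + a - s)) t = truncConv k a ξ u (ξ + a - t) := by
  have := intervalIntegral.integral_comp_sub_left (fun s => k (ξ + a - t - s) (u s)) (ξ + a)
    (a := a) (b := ξ)
  rw [add_sub_cancel_left, add_sub_cancel_right] at this
  rw [truncConv, truncConv, ← this]
  refine intervalIntegral.integral_congr fun s _ => ?_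
  rw [← heven (t - s), show -(t - s) = ξ + a - t - (ξ + a - s) by ring]

lemma truncConv_comp_add_right (hk : Integrable k) (hu : Continuous u) (h : ℝ) :
    truncConv k a ξ (fun s => u (s + h)) t =
      truncConv k a (ξ + h) u (t + h) - ∫ s in a..a + h, k (t + h - s) (u s) := by
  have hshift := intervalIntegral.integral_comp_add_right (fun s => k (t + h - s) (u s)) h
    (a := a) (b := ξ)
  simp only [add_sub_add_right_eq_sub] at hshift
  rw [truncConv, hshift, truncConv, eq_sub_iff_add_eq',
    intervalIntegral.integral_add_adjacent_intervals (intervalIntegrable_kernel_apply hk hu _ _ _)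
      (intervalIntegrable_kernel_apply hk hu _ _ _)]

lemma translate_sub_add_truncConv (hk : Integrable k) (hu : Continuous u) {c : V}
    (heq : ∀ t ∈ Icc a ξ, u t + truncConv k a ξ u t = c) {h : ℝ} (hh : 0 ≤ h)
    (ht : t ∈ Icc a (ξ - h)) :
    u (t + h) - u t + truncConv k a (ξ - h) (fun s => u (s + h) - u s) t =
      (∫ s in ξ - h..ξ, k (t - s) (u s)) - ∫ s in a..a + h, k (t + h - s) (u s) := by
  rw [truncConv_sub hk (by fun_prop) hu, truncConv_comp_add_right hk hu, sub_add_cancel,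
    eq_sub_of_add_eq (heq t ⟨ht.1, by linarith [ht.2]⟩),
    eq_sub_of_add_eq (heq (t + h) ⟨by linarith [ht.1], by linarith [ht.2]⟩),
    truncConv_eq_add_integral (t := t) hk hu (ξ - h) ξ]
  abel

lemma eq_const_of_locally_eq {E : Type*} [NormedAddCommGroup E] [NormedSpace ℝ E] {u : ℝ → E}
    {η δ : ℝ} (hu : Continuous u) (hδ : 0 < δ)
    (h : ∀ x y, a ≤ x → x ≤ y → y ≤ η → y - x ≤ δ → u y = u x) :
    ∀ t ∈ Icc a η, u t = u a := by
  refine constant_of_has_deriv_right_zero hu.continuousOn fun x hx =>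
    ((hasDerivWithinAt_const x (Ici x) (u x)).congr_of_eventuallyEq ?_ rfl)
  filter_upwards [Icc_mem_nhdsGE (lt_min hx.2 (lt_add_of_pos_right x hδ))] with y hy
  exact h x y hx.1 hy.1 (hy.2.trans (min_le_left _ _))
    (sub_le_iff_le_add'.2 (hy.2.trans (min_le_right _ _)))

lemma InjectiveTruncations.apply_left_eq_apply_right
    (hinj : InjectiveTruncations k a b) (hk : Integrable k) (heven : ∀ x, k (-x) = k x)
    (hξ : ξ ∈ Icc a b) (hu : Continuous u) {c : V}
    (heq : ∀ t ∈ Icc a ξ, u t + truncConv k a ξ u t = c) : u a = u ξ := by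
  have := hinj.eqOn hk hξ hu (hu.comp (continuous_sub_left (ξ + a))) (fun t ht => ?_)
    (left_mem_Icc.2 hξ.1)
  · simpa using this
  · have hmem : ξ + a - t ∈ Icc a ξ := ⟨by linarith [ht.2], by linarith [ht.1]⟩
    rw [heq t ht, ← heq _ hmem, ← truncConv_reflect heven]
    rfl

variable [FiniteDimensional ℝ V]

lemma InjectiveTruncations.exists_norm_le (hinj : InjectiveTruncations k a b) (hk : Integrable k)
    (hab : a ≤ b) :
    ∃ C, 0 ≤ C ∧ ∀ ξ ∈ Icc a b, ∀ u : ℝ → V, Continuous u → ∀ m,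
      (∀ t ∈ Icc a ξ, ‖u t + truncConv k a ξ u t‖ ≤ m) → ∀ t ∈ Icc a ξ, ‖u t‖ ≤ C * m := by
  obtain ⟨C, hC0, hC⟩ := hinj.exists_activeSum_norm_le hk hab
  refine ⟨C, hC0, fun ξ hξ u hu m hm t ht => ?_⟩
  have hsingle {h : ℝ → ℝ} {s : ℝ} (hs : s ≤ ξ) :
      activeSum {0} (fun _ => ξ) (fun _ => h) s = h s := by
    simp [activeSum, hs]
  have hm0 : 0 ≤ m := (norm_nonneg _).trans (hm a ⟨le_rfl, hξ.1⟩)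
  rw [← hsingle (h := fun s => ‖u s‖) ht.2]
  refine hC {0} (fun _ => ξ) (fun _ _ => hξ) (fun _ => u) (fun _ _ => hu) m (fun s hs => ?_) t
    ⟨ht.1, ht.2.trans hξ.2⟩
  rcases le_or_gt s ξ with h | h
  · exact (hsingle (h := fun s => ‖u s + truncConv k a ξ u s‖) h).trans_le (hm s ⟨hs.1, h⟩)
  · simpa [activeSum, h.not_ge] using hm0

namespace InjectiveTruncations

/-- Translating `u` by `h` changes the truncated equation only by integrals over intervals of
length `h` at the two end points, where `u` is small. -/
lemma exists_norm_sub_le_half (hinj : InjectiveTruncations k a b) (hk : Integrable k)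
    (hξ : ξ ∈ Icc a b) (hu : Continuous u) {c : V}
    (heq : ∀ t ∈ Icc a ξ, u t + truncConv k a ξ u t = c) (ha : u a = 0) (hξ0 : u ξ = 0) :
    ∃ δ > 0, ∀ m, (∀ x y, a ≤ x → x ≤ y → y ≤ ξ → y - x ≤ δ → ‖u y - u x‖ ≤ m) →
      ∀ x y, a ≤ x → x ≤ y → y ≤ ξ → y - x ≤ δ → ‖u y - u x‖ ≤ m / 2 := by
  obtain ⟨C, hC0, hC⟩ := hinj.exists_norm_le hk (hξ.1.trans hξ.2)
  obtain ⟨δ, hδ, hsmall⟩ := exists_integral_norm_lt hk (ε := 1 / (4 * (C + 1))) (by positivity)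
  refine ⟨δ / 2, half_pos hδ, fun m hm x y hax hxy hyξ hlen => ?_⟩
  set h := y - x
  have hh : 0 ≤ h := sub_nonneg.2 hxy
  have hm0 : 0 ≤ m := (norm_nonneg _).trans (hm x y hax hxy hyξ hlen)
  have hend {c' d s : ℝ} (hcd : d - c' = h) (hc : ∀ s ∈ Icc c' d, ‖u s‖ ≤ m) :
      ‖∫ r in c'..d, k (s - r) (u r)‖ ≤ m * (1 / (4 * (C + 1))) :=
    (norm_integral_kernel_apply_le hk (by linarith) hc s).trans
      (mul_le_mul_of_nonneg_left (hsmall _ _ (by linarith) (by linarith) s).le hm0)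
  have hres (t) (ht : t ∈ Icc a (ξ - h)) :
      ‖u (t + h) - u t + truncConv k a (ξ - h) (fun s => u (s + h) - u s) t‖ ≤
        2 * (m * (1 / (4 * (C + 1)))) := by
    rw [translate_sub_add_truncConv hk hu heq hh ht, two_mul]
    refine (norm_sub_le _ _).trans (add_le_add (hend (by ring) fun s hs => ?_)
      (hend (by ring) fun s hs => ?_))
    · simpa [hξ0] using hm s ξ (by linarith [hs.1, ht.1, ht.2]) hs.2 le_rfl (by linarith [hs.1])
    · simpa [ha] using hm a s le_rfl hs.1 (by linarith [hs.2, ht.1, ht.2]) (by linarith [hs.2])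
  have hbound := hC (ξ - h) ⟨by linarith, by linarith [hξ.2]⟩ (fun s => u (s + h) - u s)
    (by fun_prop) _ hres x ⟨hax, by linarith⟩
  simp only [show x + h = y from add_sub_cancel x y] at hbound
  refine hbound.trans ?_
  rw [show C * (2 * (m * (1 / (4 * (C + 1))))) = m / 2 * (C / (C + 1)) by
    field_simp
    ring]
  exact mul_le_of_le_one_right (by positivity) ((div_le_one (by positivity)).2 (by linarith))

/-- A solution with constant right side and zero final value has zero initial value by symmetry;
then the translation estimate makes it locally constant. -/
theorem const_eq_zero_of_apply_eq_zero (hinj : InjectiveTruncations k a b) (hk : Integrable k)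
    (heven : ∀ x, k (-x) = k x) (hξ : ξ ∈ Icc a b) (hu : Continuous u) {c : V}
    (heq : ∀ t ∈ Icc a ξ, u t + truncConv k a ξ u t = c) (hξ0 : u ξ = 0) : c = 0 := by
  have ha : u a = 0 := (hinj.apply_left_eq_apply_right hk heven hξ hu heq).trans hξ0
  obtain ⟨δ, hδ, hhalf⟩ := hinj.exists_norm_sub_le_half hk hξ hu heq ha hξ0
  let S : Set (ℝ × ℝ) := {p | a ≤ p.1 ∧ p.1 ≤ p.2 ∧ p.2 ≤ ξ ∧ p.2 - p.1 ≤ δ}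
  obtain ⟨B, hB⟩ := isCompact_Icc.exists_bound_of_continuousOn (hu.continuousOn (s := Icc a ξ))
  have hbdd : BddAbove (range fun p : S => ‖u p.1.2 - u p.1.1‖) := by
    refine ⟨B + B, ?_⟩
    rintro _ ⟨⟨p, hp⟩, rfl⟩
    exact (norm_sub_le _ _).trans (add_le_add (hB _ ⟨hp.1.trans hp.2.1, hp.2.2.1⟩)
      (hB _ ⟨hp.1, hp.2.1.trans hp.2.2.1⟩))
  have hlocal (x y : ℝ) (hax : a ≤ x) (hxy : x ≤ y) (hyξ : y ≤ ξ) (hlen : y - x ≤ δ) :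
      u y = u x := by
    have := le_two_mul_of_forall_le_add_half (A := 0) hbdd (fun m hm p => by
      rw [zero_add]
      exact hhalf m (fun x y h1 h2 h3 h4 => hm ⟨(x, y), h1, h2, h3, h4⟩) _ _ p.2.1 p.2.2.1
        p.2.2.2.1 p.2.2.2.2) ⟨(x, y), hax, hxy, hyξ, hlen⟩
    rw [mul_zero] at this
    exact sub_eq_zero.1 (norm_le_zero_iff.1 this)
  have hzero : EqOn u (fun _ => 0) (Icc a ξ) := fun t ht =>
    (eq_const_of_locally_eq hu hδ hlocal t ht).trans ha
  rw [← heq a (left_mem_Icc.2 hξ.1), truncConv_congr hξ.1 hzero, ha]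
  simp [truncConv]

end InjectiveTruncations

end Diagonal

section Moments

lemma IsSolutionFamily.continuous_apply {V : Type*} [NormedAddCommGroup V] [NormedSpace ℝ V]
    {k : ℝ → V →L[ℝ] V} {a b : ℝ} {f : ℝ → V} {φ : ℝ → ℝ → V} (hφ : IsSolutionFamily k a b f φ)
    (ξ : ℝ) : Continuous (φ ξ) :=
  hφ.continuous.comp (Continuous.prodMk_right ξ)

lemma IsSolutionFamily.continuous_diag {V : Type*} [NormedAddCommGroup V] [NormedSpace ℝ V]
    {k : ℝ → V →L[ℝ] V} {a b : ℝ} {f : ℝ → V} {φ : ℝ → ℝ → V} (hφ : IsSolutionFamily k a b f φ) :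
    Continuous fun ξ => φ ξ ξ :=
  hφ.continuous.comp (continuous_id.prodMk continuous_id)

lemma hasDerivWithinAt_of_sub_eq_integral {U : Type*} [NormedAddCommGroup U] [NormedSpace ℝ U]
    [CompleteSpace U] {m : ℝ → U} {p : ℝ → ℝ → U} {S : Set ℝ} {ξ : ℝ}
    (hp : Continuous fun z : ℝ × ℝ => p z.1 z.2)
    (hm : ∀ η ∈ S, m η - m ξ = ∫ s in ξ..η, p η s) : HasDerivWithinAt m (p ξ ξ) S ξ := by
  refine hasDerivWithinAt_iff_isLittleO.2 (Asymptotics.isLittleO_iff.2 fun ε hε => ?_)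
  obtain ⟨δ, hδ, hpδ⟩ := Metric.continuousAt_iff.1 (hp.continuousAt (x := (ξ, ξ))) ε hε
  filter_upwards [self_mem_nhdsWithin, mem_nhdsWithin_of_mem_nhds (Metric.ball_mem_nhds ξ hδ)]
    with η hηS hη
  have hsub : m η - m ξ - (η - ξ) • p ξ ξ = ∫ s in ξ..η, (p η s - p ξ ξ) := by
    have hpη : Continuous (p η) := hp.comp (Continuous.prodMk_right η)
    rw [hm η hηS, intervalIntegral.integral_sub (hpη.intervalIntegrable _ _)
      intervalIntegrable_const, intervalIntegral.integral_const]
  rw [hsub, Real.norm_eq_abs]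
  refine intervalIntegral.norm_integral_le_of_norm_le_const fun s hs => ?_
  rw [← dist_eq_norm]
  refine (hpδ (x := (η, s)) (max_lt hη ?_)).le
  rw [dist_comm]
  exact (Real.dist_left_le_of_mem_uIcc (uIoc_subset_uIcc hs)).trans_lt (by rwa [dist_comm])

variable {V W U : Type*} [NormedAddCommGroup V] [NormedSpace ℝ V] [NormedAddCommGroup W]
  [NormedSpace ℝ W] [NormedAddCommGroup U] [NormedSpace ℝ U] [CompleteSpace V] [CompleteSpace W]
  [CompleteSpace U] {k : ℝ → V →L[ℝ] V} {l : ℝ → W →L[ℝ] W} {B : W →L[ℝ] V →L[ℝ] U} {a b ξ η : ℝ}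
  {f : ℝ → V} {φ : ℝ → ℝ → V} {f' : ℝ → W} {χ : ℝ → ℝ → W}

lemma integral_pairing_sub_integral_pairing (hB : ∀ x w v, B (l x w) v = B w (k (-x) v))
    (hk : Integrable k) (hl : Integrable l) (hφ : IsSolutionFamily k a b f φ)
    (hχ : IsSolutionFamily l a b f' χ) (hξ : ξ ∈ Icc a b) (hη : η ∈ Icc a b) :
    (∫ s in a..η, B (f' s) (φ η s)) - ∫ s in a..ξ, B (χ ξ s) (f s) =
      ∫ s in ξ..η, B (χ ξ s) (φ η s) := by
  have hχξ := hχ.continuous_apply ξ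
  have hφη := hφ.continuous_apply η
  have hlχ := continuous_truncConv hl hξ.1 hχξ
  have hkφ := continuous_truncConv hk hη.1 hφη
  have hint (c d : ℝ) : IntervalIntegrable (fun s => B (χ ξ s) (φ η s)) volume c d :=
    Continuous.intervalIntegrable (by fun_prop) c d
  have hleft : ∫ s in a..η, B (f' s) (φ η s) = (∫ s in a..η, B (χ ξ s) (φ η s)) +
      ∫ s in a..η, B (truncConv l a ξ (χ ξ) s) (φ η s) := by
    rw [← intervalIntegral.integral_add (hint _ _)
      (Continuous.intervalIntegrable (by fun_prop) _ _)]
    refine intervalIntegral.integral_congr fun s hs => ?_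
    rw [uIcc_of_le hη.1] at hs
    simp only [← hχ.eq ξ hξ s ⟨hs.1, hs.2.trans hη.2⟩, map_add, add_apply]
  have hright : ∫ s in a..ξ, B (χ ξ s) (f s) = (∫ s in a..ξ, B (χ ξ s) (φ η s)) +
      ∫ s in a..ξ, B (χ ξ s) (truncConv k a η (φ η) s) := by
    rw [← intervalIntegral.integral_add (hint _ _)
      (Continuous.intervalIntegrable (by fun_prop) _ _)]
    refine intervalIntegral.integral_congr fun s hs => ?_
    rw [uIcc_of_le hξ.1] at hs
    simp only [← hφ.eq η hη s ⟨hs.1, hs.2.trans hξ.2⟩, map_add]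
  rw [hleft, hright, integral_pairing_truncConv hB hk hl hξ.1 hη.1 hχξ hφη,
    add_sub_add_right_eq_sub, intervalIntegral.integral_interval_sub_left (hint _ _) (hint _ _)]

lemma integral_pairing_eq_integral_pairing (hB : ∀ x w v, B (l x w) v = B w (k (-x) v))
    (hk : Integrable k) (hl : Integrable l) (hφ : IsSolutionFamily k a b f φ)
    (hχ : IsSolutionFamily l a b f' χ) (hξ : ξ ∈ Icc a b) :
    ∫ s in a..ξ, B (f' s) (φ ξ s) = ∫ s in a..ξ, B (χ ξ s) (f s) := by
  rw [← sub_eq_zero, integral_pairing_sub_integral_pairing hB hk hl hφ hχ hξ hξ,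
    intervalIntegral.integral_same]

theorem hasDerivWithinAt_integral_pairing (hB : ∀ x w v, B (l x w) v = B w (k (-x) v))
    (hk : Integrable k) (hl : Integrable l) (hφ : IsSolutionFamily k a b f φ)
    (hχ : IsSolutionFamily l a b f' χ) (hξ : ξ ∈ Icc a b) :
    HasDerivWithinAt (fun η => ∫ s in a..η, B (f' s) (φ η s)) (B (χ ξ ξ) (φ ξ ξ)) (Icc a b) ξ := by
  have hχξ := hχ.continuous_apply ξ
  have hφc := hφ.continuous
  refine hasDerivWithinAt_of_sub_eq_integral (p := fun η s => B (χ ξ s) (φ η s)) (by fun_prop)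
    fun η hη => ?_
  rw [← integral_pairing_sub_integral_pairing hB hk hl hφ hχ hξ hη,
    ← integral_pairing_eq_integral_pairing hB hk hl hφ hχ hξ]

end Moments

section Stieltjes

open scoped Matrix.Norms.Operator

lemma monotoneOn_Iic_of_le_succ {N : ℕ} {x : ℕ → ℝ} (hx : ∀ i < N, x i ≤ x (i + 1)) :
    MonotoneOn x (Iic N) :=
  monotoneOn_of_le_succ ordConnected_Iic fun i _ _ hi => hx i (Nat.lt_of_succ_le hi)

lemma exists_partition {c d δ : ℝ} (hcd : c ≤ d) (hδ : 0 < δ) :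
    ∃ (N : ℕ) (x : ℕ → ℝ), x 0 = c ∧ x N = d ∧ ∀ i, x i ≤ x (i + 1) ∧ x (i + 1) - x i < δ := by
  obtain ⟨N, hN⟩ := exists_nat_gt ((d - c) / δ)
  have hN0 : (0 : ℝ) < N := (div_nonneg (sub_nonneg.2 hcd) hδ.le).trans_lt hN
  refine ⟨N, fun i => c + i * ((d - c) / N), by simp, ?_, fun i => ?_⟩
  · field_simp
    ring
  · have hstep : c + (i + 1 : ℕ) * ((d - c) / N) - (c + i * ((d - c) / N)) = (d - c) / N := by
      push_cast
      ring
    rw [← sub_nonneg, hstep]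
    exact ⟨div_nonneg (sub_nonneg.2 hcd) hN0.le, (div_lt_comm₀ hδ hN0).1 hN⟩

/-- The product `A *ᵥ v` as a continuous bilinear map. -/
def mulVecCLM (n : ℕ) : Matrix (Fin n) (Fin n) ℂ →L[ℝ] (Fin n → ℂ) →L[ℝ] (Fin n → ℂ) :=
  (Matrix.mulVecBilin ℝ ℝ).toContinuousBilinearMap

/-- The matrix kernel `K` acting on vectors by `v ↦ K x *ᵥ v`. -/
abbrev vecKernel {n : ℕ} (K : ℝ → Matrix (Fin n) (Fin n) ℂ) (x : ℝ) :
    (Fin n → ℂ) →L[ℝ] (Fin n → ℂ) :=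
  mulVecCLM n (K x)

/-- The matrix kernel `K` acting on matrices by left multiplication. -/
abbrev leftKernel {n : ℕ} (K : ℝ → Matrix (Fin n) (Fin n) ℂ) (x : ℝ) :
    Matrix (Fin n) (Fin n) ℂ →L[ℝ] Matrix (Fin n) (Fin n) ℂ :=
  ContinuousLinearMap.mul ℝ _ (K x)

/-- The matrix kernel `K` acting on matrices by right multiplication. -/
abbrev rightKernel {n : ℕ} (K : ℝ → Matrix (Fin n) (Fin n) ℂ) (x : ℝ) :
    Matrix (Fin n) (Fin n) ℂ →L[ℝ] Matrix (Fin n) (Fin n) ℂ :=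
  (ContinuousLinearMap.mul ℝ _).flip (K x)

variable {n : ℕ} {A : ℝ → Matrix (Fin n) (Fin n) ℂ} {F : ℝ → Fin n → ℂ} {c d : ℝ} {J : Fin n → ℂ}

lemma HasStieltjesIntegral.unique {J' : Fin n → ℂ} (hcd : c ≤ d)
    (h : HasStieltjesIntegral A F c d J) (h' : HasStieltjesIntegral A F c d J') : J = J' := by
  refine eq_of_forall_dist_le fun ε hε => ?_
  obtain ⟨δ, hδ, h⟩ := h _ (half_pos hε)
  obtain ⟨δ', hδ', h'⟩ := h' _ (half_pos hε)
  obtain ⟨N, x, h0, hN, hx⟩ := exists_partition hcd (lt_min hδ hδ')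
  have hJ := h N x x h0 hN fun i _ => ⟨le_rfl, (hx i).1, (hx i).2.trans_le (min_le_left _ _)⟩
  have hJ' := h' N x x h0 hN fun i _ => ⟨le_rfl, (hx i).1, (hx i).2.trans_le (min_le_right _ _)⟩
  rw [← dist_eq_norm] at hJ hJ'
  linarith [dist_triangle_left J J' (∑ i ∈ Finset.range N, A (x i) *ᵥ (F (x (i + 1)) - F (x i)))]

lemma HasStieltjesIntegral.congr {A' : ℝ → Matrix (Fin n) (Fin n) ℂ} {F' : ℝ → Fin n → ℂ}
    (h : HasStieltjesIntegral A F c d J) (hA : EqOn A A' (Icc c d)) (hF : EqOn F F' (Icc c d)) :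
    HasStieltjesIntegral A' F' c d J := by
  intro ε hε
  obtain ⟨δ, hδ, h⟩ := h ε hε
  refine ⟨δ, hδ, fun N x τ h0 hN hx => ?_⟩
  have hmono := monotoneOn_Iic_of_le_succ fun i hi => (hx i hi).1.trans (hx i hi).2.1
  have hmem (i : ℕ) (hi : i ≤ N) : x i ∈ Icc c d :=
    ⟨h0 ▸ hmono N.zero_le hi i.zero_le, hN ▸ hmono hi self_mem_Iic hi⟩
  have hsum : ∑ i ∈ Finset.range N, A' (τ i) *ᵥ (F' (x (i + 1)) - F' (x i)) =
      ∑ i ∈ Finset.range N, A (τ i) *ᵥ (F (x (i + 1)) - F (x i)) :=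
    Finset.sum_congr rfl fun i hi => by
      have hi := Finset.mem_range.1 hi
      rw [hF (hmem i hi.le), hF (hmem (i + 1) hi),
        hA ⟨(hmem i hi.le).1.trans (hx i hi).1, (hx i hi).2.1.trans (hmem (i + 1) hi).2⟩]
  rw [hsum]
  exact h N x τ h0 hN hx

lemma sum_mulVec_sub_add_sum_sub_mulVec (P : ℕ → Matrix (Fin n) (Fin n) ℂ) (y : ℕ → Fin n → ℂ)
    (N : ℕ) :
    ∑ i ∈ Finset.range N, P (i + 1) *ᵥ (y (i + 1) - y i) +
        ∑ i ∈ Finset.range (N + 1), (P (i + 1) - P i) *ᵥ y i =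
      P (N + 1) *ᵥ y N - P 0 *ᵥ y 0 := by
  induction N with
  | zero => simp [Matrix.sub_mulVec]
  | succ N ih =>
    rw [Finset.sum_range_succ, Finset.sum_range_succ _ (N + 1), add_add_add_comm, ih,
      Matrix.mulVec_sub, Matrix.sub_mulVec]
    abel

/-- Summation by parts; the interlacing points `p` are the tags, together with the end points. -/
lemma hasStieltjesIntegral_of_interlaced {ψ : ℝ → Fin n → ℂ}
    (h : ∀ ε > 0, ∃ δ > 0, ∀ (N : ℕ) (p x : ℕ → ℝ), p 0 = c → p N = d →
      (∀ i < N, p i ≤ x i ∧ x i ≤ p (i + 1) ∧ p (i + 1) - p i < δ) →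
      ‖∑ i ∈ Finset.range N,
        (ψ (p (i + 1)) - ψ (p i) - (A (p (i + 1)) - A (p i)) *ᵥ F (x i))‖ < ε) :
    HasStieltjesIntegral A F c d (A d *ᵥ F d - A c *ᵥ F c - (ψ d - ψ c)) := by
  intro ε hε
  obtain ⟨δ, hδ, h⟩ := h ε hε
  refine ⟨δ / 2, half_pos hδ, fun N x τ h0 hN hx => ?_⟩
  let p : ℕ → ℝ := fun i => if i = 0 then c else if i ≤ N then τ (i - 1) else d
  have hp0 : p 0 = c := if_pos rfl
  have hpN : p (N + 1) = d := by simp [p]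
  have hpτ (i : ℕ) (hi : i < N) : p (i + 1) = τ i := by simp [p, Nat.succ_le_of_lt hi]
  have hleft (i : ℕ) (hi : i < N + 1) : p i ≤ x i ∧ x i - p i < δ / 2 := by
    rcases i with _ | i
    · rw [hp0, h0, sub_self]
      exact ⟨le_rfl, half_pos hδ⟩
    · have := hx i (by omega)
      rw [hpτ i (by omega)]
      exact ⟨this.2.1, by linarith⟩
  have hright (i : ℕ) (hi : i < N + 1) : x i ≤ p (i + 1) ∧ p (i + 1) - x i < δ / 2 := by
    rcases Nat.lt_succ_iff_lt_or_eq.1 hi with hi | rfl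
    · have := hx i hi
      rw [hpτ i hi]
      exact ⟨this.1, by linarith⟩
    · rw [hpN, hN, sub_self]
      exact ⟨le_rfl, half_pos hδ⟩
  have hsmall := h (N + 1) p x hp0 hpN fun i hi =>
    ⟨(hleft i hi).1, (hright i hi).1, by linarith [(hleft i hi).2, (hright i hi).2]⟩
  have habel := sum_mulVec_sub_add_sum_sub_mulVec (fun i => A (p i)) (fun i => F (x i)) N
  simp only [hp0, hpN, h0, hN] at habel
  rw [Finset.sum_sub_distrib, Finset.sum_range_sub (fun i => ψ (p i)), hp0, hpN] at hsmall
  rw [Finset.sum_congr rfl fun i hi => by rw [← hpτ i (Finset.mem_range.1 hi)],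
    eq_sub_of_add_eq habel]
  rwa [sub_sub_sub_cancel_left]

lemma intervalIntegrable_mulVec (hcd : c ≤ d) (hA : ContinuousOn A (Icc c d))
    (hF : IntervalIntegrable F volume c d) :
    IntervalIntegrable (fun s => A s *ᵥ F s) volume c d := by
  obtain ⟨m, hm⟩ := isCompact_Icc.exists_bound_of_continuousOn hA
  rw [intervalIntegrable_iff_integrableOn_Ioc_of_le hcd] at hF ⊢
  have : TopologicalSpace.PseudoMetrizableSpace (Matrix (Fin n) (Fin n) ℂ) :=
    inferInstanceAs (TopologicalSpace.PseudoMetrizableSpace (Fin n → Fin n → ℂ))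
  exact (mulVecCLM n).integrable_of_bilin_of_bdd_left m
    ((hA.mono Ioc_subset_Icc_self).aestronglyMeasurable measurableSet_Ioc)
    (ae_restrict_of_forall_mem measurableSet_Ioc fun s hs => hm s (Ioc_subset_Icc_self hs)) hF

lemma norm_mulVec_sub_integral_mulVec_le {F' : ℝ → Fin n → ℂ} {ε τ : ℝ} (hcd : c ≤ d)
    (hA : ContinuousOn A (Icc c d)) (hF' : IntervalIntegrable F' volume c d)
    (hF : F d - F c = ∫ s in c..d, F' s) (hτ : ∀ s ∈ Icc c d, ‖A τ - A s‖ ≤ ε) :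
    ‖A τ *ᵥ (F d - F c) - ∫ s in c..d, A s *ᵥ F' s‖ ≤ ε * ∫ s in c..d, ‖F' s‖ := by
  have hconst : A τ *ᵥ (F d - F c) = ∫ s in c..d, A τ *ᵥ F' s := by
    rw [hF]
    exact ((mulVecCLM n (A τ)).intervalIntegral_comp_comm hF').symm
  rw [hconst, ← intervalIntegral.integral_sub
    (intervalIntegrable_mulVec hcd continuousOn_const hF') (intervalIntegrable_mulVec hcd hA hF'),
    ← intervalIntegral.integral_const_mul]
  refine intervalIntegral.norm_integral_le_of_norm_le hcd (ae_of_all _ fun s hs => ?_)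
    (hF'.norm.const_mul ε)
  rw [← Matrix.sub_mulVec]
  exact (Matrix.linfty_opNorm_mulVec _ _).trans
    (mul_le_mul_of_nonneg_right (hτ s (Ioc_subset_Icc_self hs)) (norm_nonneg _))

lemma hasStieltjesIntegral_integral_mulVec {F' : ℝ → Fin n → ℂ} (hcd : c ≤ d)
    (hA : ContinuousOn A (Icc c d)) (hF' : IntervalIntegrable F' volume c d)
    (hF : ∀ x ∈ Icc c d, ∀ y ∈ Icc c d, F y - F x = ∫ s in x..y, F' s) :
    HasStieltjesIntegral A F c d (∫ s in c..d, A s *ᵥ F' s) := by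
  intro ε hε
  set q := ∫ s in c..d, ‖F' s‖
  have hq : 0 ≤ q := intervalIntegral.integral_nonneg hcd fun _ _ => norm_nonneg _
  obtain ⟨δ, hδ, hAδ⟩ := Metric.uniformContinuousOn_iff_le.1
    (isCompact_Icc.uniformContinuousOn_of_continuous hA) (ε / (q + 1)) (by positivity)
  refine ⟨δ, hδ, fun N x τ h0 hN hx => ?_⟩
  have hmono := monotoneOn_Iic_of_le_succ fun i hi => (hx i hi).1.trans (hx i hi).2.1
  have hmem (i : ℕ) (hi : i ≤ N) : x i ∈ Icc c d :=
    ⟨h0 ▸ hmono N.zero_le hi i.zero_le, hN ▸ hmono hi self_mem_Iic hi⟩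
  have hcell (i : ℕ) (hi : i < N) : Icc (x i) (x (i + 1)) ⊆ Icc c d :=
    Icc_subset_Icc (hmem i hi.le).1 (hmem (i + 1) hi).2
  have hF'i (i : ℕ) (hi : i < N) : IntervalIntegrable F' volume (x i) (x (i + 1)) :=
    hF'.mono_set (uIcc_subset_uIcc (Icc_subset_uIcc (hmem i hi.le))
      (Icc_subset_uIcc (hmem (i + 1) hi)))
  have hle (i : ℕ) (hi : i < N) : x i ≤ x (i + 1) := (hx i hi).1.trans (hx i hi).2.1
  have hterm (i : ℕ) (hi : i < N) :
      ‖A (τ i) *ᵥ (F (x (i + 1)) - F (x i)) - ∫ s in x i..x (i + 1), A s *ᵥ F' s‖ ≤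
        ε / (q + 1) * ∫ s in x i..x (i + 1), ‖F' s‖ := by
    refine norm_mulVec_sub_integral_mulVec_le (hle i hi) (hA.mono (hcell i hi)) (hF'i i hi)
      (hF _ (hmem i hi.le) _ (hmem (i + 1) hi)) fun s hs => ?_
    rw [← dist_eq_norm]
    exact hAδ _ (hcell i hi ⟨(hx i hi).1, (hx i hi).2.1⟩) _ (hcell i hi hs)
      ((Real.dist_le_of_mem_Icc ⟨(hx i hi).1, (hx i hi).2.1⟩ hs).trans (hx i hi).2.2.le)
  have hsplit : ∫ s in c..d, A s *ᵥ F' s =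
      ∑ i ∈ Finset.range N, ∫ s in x i..x (i + 1), A s *ᵥ F' s := by
    rw [intervalIntegral.sum_integral_adjacent_intervals fun i hi =>
      intervalIntegrable_mulVec (hle i hi) (hA.mono (hcell i hi)) (hF'i i hi), h0, hN]
  rw [hsplit, ← Finset.sum_sub_distrib]
  calc _ ≤ ∑ i ∈ Finset.range N, ε / (q + 1) * ∫ s in x i..x (i + 1), ‖F' s‖ :=
        norm_sum_le_of_le _ fun i hi => hterm i (Finset.mem_range.1 hi)
    _ = ε / (q + 1) * q := by
        rw [← Finset.mul_sum, intervalIntegral.sum_integral_adjacent_intervals fun i hi =>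
          (hF'i i hi).norm, h0, hN]
    _ < ε := by
        rw [div_mul_eq_mul_div, div_lt_iff₀ (by positivity)]
        exact mul_lt_mul_of_pos_left (lt_add_one q) hε

end Stieltjes

section Increments

lemma exists_norm_le_of_diag_eq_zero {V : Type*} [SeminormedAddCommGroup V] {a b : ℝ}
    {Φ : ℝ → ℝ → ℝ → V}
    (hΦ : ContinuousOn (fun p : ℝ × ℝ × ℝ => Φ p.1 p.2.1 p.2.2)
      (Icc a b ×ˢ Icc a b ×ˢ Icc a b))
    (hdiag : ∀ x ∈ Icc a b, Φ x x x = 0) {m : ℝ} (hm : 0 < m) :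
    ∃ δ > 0, ∀ x ∈ Icc a b, ∀ y ∈ Icc a b, ∀ z ∈ Icc a b, dist y x < δ → dist z x < δ →
      ‖Φ x y z‖ ≤ m := by
  obtain ⟨δ, hδ, h⟩ := Metric.uniformContinuousOn_iff_le.1
    ((isCompact_Icc.prod (isCompact_Icc.prod isCompact_Icc)).uniformContinuousOn_of_continuous hΦ)
    m hm
  refine ⟨δ, hδ, fun x hx y hy z hz hyx hzx => ?_⟩
  have hdist : dist (x, y, z) (x, x, x) ≤ δ := by
    rw [Prod.dist_eq, Prod.dist_eq, dist_self]
    exact max_le hδ.le (max_le hyx.le hzx.le)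
  simpa only [hdiag x hx, dist_zero_right] using
    h (x, y, z) ⟨hx, hy, hz⟩ (x, x, x) ⟨hx, hx, hx⟩ hdist

variable {V W : Type*} [NormedAddCommGroup V] [NormedSpace ℝ V] [NormedAddCommGroup W]
  [NormedSpace ℝ W] {k : ℝ → V →L[ℝ] V} {l : ℝ → W →L[ℝ] W} {a b : ℝ} {f g : ℝ → V}
  {φ ψ : ℝ → ℝ → V}

lemma IsSolutionFamily.map [CompleteSpace V] [CompleteSpace W] (P : V →L[ℝ] W)
    (hP : ∀ x v, P (k x v) = l x (P v)) (hk : Integrable k) (hφ : IsSolutionFamily k a b f φ) :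
    IsSolutionFamily l a b (fun t => P (f t)) fun ξ t => P (φ ξ t) where
  continuous := P.continuous.comp hφ.continuous
  eq ξ hξ t ht := by
    rw [← map_truncConv P hP hk (hφ.continuous_apply ξ), ← map_add, hφ.eq ξ hξ t ht]

lemma IsSolutionFamily.sub (hk : Integrable k) (hφ : IsSolutionFamily k a b f φ)
    (hψ : IsSolutionFamily k a b g ψ) :
    IsSolutionFamily k a b (fun t => f t - g t) fun ξ t => φ ξ t - ψ ξ t where
  continuous := hφ.continuous.sub hψ.continuous
  eq ξ hξ t ht := by
    rw [truncConv_sub hk (hφ.continuous_apply ξ) (hψ.continuous_apply ξ), sub_add_sub_comm,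
      hφ.eq ξ hξ t ht, hψ.eq ξ hξ t ht]

theorem InjectiveTruncations.exists_sum_norm_increment_le [FiniteDimensional ℝ V]
    (hinj : InjectiveTruncations k a b) (hk : Integrable k) (hab : a ≤ b) :
    ∃ C, 0 ≤ C ∧ ∀ (N : ℕ) (p : ℕ → ℝ), (∀ i < N, p i ≤ p (i + 1)) → a ≤ p 0 → p N ≤ b →
      ∀ (f : ℕ → ℝ → V) (φ : ℕ → ℝ → ℝ → V), (∀ i, IsSolutionFamily k a b (f i) (φ i)) →
      ∀ m, 0 ≤ m → (∀ i < N, ∀ s ∈ Icc (p i) (p (i + 1)), ‖φ i (p (i + 1)) s‖ ≤ m) →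
      ∀ t ∈ Icc a (p 0),
        ∑ i ∈ Finset.range N, ‖φ i (p (i + 1)) t - φ i (p i) t‖ ≤ C * m := by
  obtain ⟨C, hC0, hC⟩ := hinj.exists_activeSum_norm_sub_le hk hab
  refine ⟨C * ∫ x, ‖k x‖, by positivity, fun N p hp h0 hN f φ hφ m hm0 hm t ht => ?_⟩
  have hmono := monotoneOn_Iic_of_le_succ hp
  have hmem (i : ℕ) (hi : i ≤ N) : p i ∈ Icc a b :=
    ⟨h0.trans (hmono N.zero_le hi i.zero_le), (hmono hi self_mem_Iic hi).trans hN⟩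
  have hrange {i : ℕ} (hi : i ∈ Finset.range N) : i < N := Finset.mem_range.1 hi
  have hactive : activeSum (Finset.range N) p (fun i t => ‖φ i (p (i + 1)) t - φ i (p i) t‖) t =
      ∑ i ∈ Finset.range N, ‖φ i (p (i + 1)) t - φ i (p i) t‖ := by
    rw [activeSum, Finset.filter_true_of_mem fun i hi =>
      ht.2.trans (hmono N.zero_le (hrange hi).le i.zero_le)]
  have hk0 (s : ℝ) (i : ℕ) (hi : i < N) : 0 ≤ ∫ r in p i..p (i + 1), ‖k (s - r)‖ :=
    intervalIntegral.integral_nonneg (hp i hi) fun _ _ => norm_nonneg _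
  rw [← hactive, mul_assoc]
  refine hC (Finset.range N) p (fun i => p (i + 1))
    (fun i hi => ⟨(hmem i (hrange hi).le).1, hp i (hrange hi), (hmem (i + 1) (hrange hi)).2⟩)
    (fun i => φ i (p (i + 1))) (fun i => φ i (p i)) f f
    (fun i _ => (hφ i).continuous_apply _) (fun i _ => (hφ i).continuous_apply _)
    (fun i hi t ht => (hφ i).eq _ (hmem (i + 1) (hrange hi)) t
      ⟨ht.1, ht.2.trans (hmem i (hrange hi).le).2⟩)
    (fun i hi t ht => (hφ i).eq _ (hmem i (hrange hi).le) t
      ⟨ht.1, ht.2.trans (hmem i (hrange hi).le).2⟩)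
    m (fun i hi => hm i (hrange hi)) _ (fun s _ => ?_) t
    ⟨ht.1, ht.2.trans (hmem 0 N.zero_le).2⟩
  simp only [sub_self, norm_zero, zero_add]
  calc activeSum (Finset.range N) p (fun i s => m * ∫ r in p i..p (i + 1), ‖k (s - r)‖) s
      ≤ ∑ i ∈ Finset.range N, m * ∫ r in p i..p (i + 1), ‖k (s - r)‖ :=
        activeSum_le_sum (h := fun i s => m * ∫ r in p i..p (i + 1), ‖k (s - r)‖) fun i hi =>
          mul_nonneg hm0 (hk0 s i (hrange hi))
    _ = m * ∫ r in p 0..p N, ‖k (s - r)‖ := by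
        rw [← Finset.mul_sum, intervalIntegral.sum_integral_adjacent_intervals fun i _ =>
          intervalIntegrable_norm_comp_sub hk s _ _]
    _ ≤ (∫ x, ‖k x‖) * m := by
        rw [mul_comm]
        exact mul_le_mul_of_nonneg_right
          (integral_norm_comp_sub_le hk (hmono N.zero_le self_mem_Iic N.zero_le) s) hm0

end Increments

section MatrixFamilies

open scoped Matrix.Norms.Operator

variable {n : ℕ} {K : ℝ → Matrix (Fin n) (Fin n) ℂ} {G : ℝ → ℝ → Matrix (Fin n) (Fin n) ℂ}
  {φ : ℝ → ℝ → Fin n → ℂ} {F f : ℝ → Fin n → ℂ} {a b t : ℝ}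

lemma integrable_clm_matrix_comp {E : Type*} [NormedAddCommGroup E] [NormedSpace ℝ E]
    (L : Matrix (Fin n) (Fin n) ℂ →L[ℝ] E) (hK : ∀ i j, Integrable fun x => K x i j) :
    Integrable fun x => L (K x) :=
  let P : (Fin n → Fin n → ℂ) →L[ℝ] E :=
    ⟨L.toLinearMap ∘ₗ (Matrix.ofLinearEquiv ℝ).toLinearMap, L.continuous⟩
  P.integrable_comp (.of_eval fun i => .of_eval fun j => hK i j)

lemma IsSolutionFamily.sub_mulVec (hK : ∀ i j, Integrable fun x => K x i j)
    (hφ : IsSolutionFamily (vecKernel K) a b f φ)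
    (hG : IsSolutionFamily (leftKernel K) a b (fun _ => 1) G)
    (z : Fin n → ℂ) :
    IsSolutionFamily (vecKernel K) a b (fun t => f t - z)
      fun ξ t => φ ξ t - G ξ t *ᵥ z := by
  have hGz := hG.map (l := vecKernel K) ((mulVecCLM n).flip z)
    (fun x A => (Matrix.mulVec_mulVec z (K x) A).symm)
    (integrable_clm_matrix_comp (ContinuousLinearMap.mul ℝ _) hK)
  rw [show (mulVecCLM n).flip z 1 = z from Matrix.one_mulVec z] at hGz
  exact hφ.sub (integrable_clm_matrix_comp (mulVecCLM n) hK) hGz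

lemma exists_norm_sub_mulVec_le (hφ : Continuous fun p : ℝ × ℝ => φ p.1 p.2)
    (hG : Continuous fun p : ℝ × ℝ => G p.1 p.2) (hF : ContinuousOn F (Icc a b))
    (hdiag : ∀ ξ ∈ Icc a b, φ ξ ξ = G ξ ξ *ᵥ F ξ) {m : ℝ} (hm : 0 < m) :
    ∃ δ > 0, ∀ x ∈ Icc a b, ∀ y ∈ Icc a b, ∀ z ∈ Icc a b, dist y x < δ → dist z x < δ →
      ‖φ y z - G y z *ᵥ F x‖ ≤ m := by
  have hFc : ContinuousOn (fun p : ℝ × ℝ × ℝ => F p.1) (Icc a b ×ˢ Icc a b ×ˢ Icc a b) :=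
    hF.comp continuousOn_fst fun p hp => hp.1
  exact exists_norm_le_of_diag_eq_zero (Φ := fun x ξ s => φ ξ s - G ξ s *ᵥ F x)
    ((hφ.comp continuous_snd).continuousOn.sub
      (((mulVecCLM n).continuous.comp (hG.comp continuous_snd)).continuousOn.clm_apply hFc))
    (fun x hx => sub_eq_zero.2 (hdiag x hx)) hm

/-- With `F` frozen on each cell the increments of `φ ξ t - G ξ t *ᵥ F x` are driven by values near
the diagonal, where `φ ξ ξ = G ξ ξ *ᵥ F ξ` makes them small. -/
theorem InjectiveTruncations.hasStieltjesIntegral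
    (hinj : InjectiveTruncations (vecKernel K) a b)
    (hK : ∀ i j, Integrable fun x => K x i j)
    (hφ : IsSolutionFamily (vecKernel K) a b f φ)
    (hG : IsSolutionFamily (leftKernel K) a b (fun _ => 1) G)
    (hF : ContinuousOn F (Icc a b)) (hdiag : ∀ ξ ∈ Icc a b, φ ξ ξ = G ξ ξ *ᵥ F ξ)
    (ht : t ∈ Icc a b) :
    HasStieltjesIntegral (fun ξ => G ξ t) F t b (G b t *ᵥ F b - φ b t) := by
  obtain ⟨C, hC0, hC⟩ := hinj.exists_sum_norm_increment_le
    (integrable_clm_matrix_comp (mulVecCLM n) hK) (ht.1.trans ht.2)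
  have hval : G b t *ᵥ F b - φ b t = G b t *ᵥ F b - G t t *ᵥ F t - (φ b t - φ t t) := by
    rw [hdiag t ht, sub_sub_sub_cancel_right]
  rw [hval]
  refine hasStieltjesIntegral_of_interlaced (A := fun ξ => G ξ t) (ψ := fun ξ => φ ξ t)
    fun ε hε => ?_
  obtain ⟨δ, hδ, hsmall⟩ := exists_norm_sub_mulVec_le hφ.continuous hG.continuous hF hdiag
    (m := ε / (C + 1)) (by positivity)
  refine ⟨δ, hδ, fun N p x h0 hN hx => ?_⟩
  have hle (i : ℕ) (hi : i < N) : p i ≤ p (i + 1) := (hx i hi).1.trans (hx i hi).2.1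
  have hmono := monotoneOn_Iic_of_le_succ hle
  have hcell (i : ℕ) (hi : i < N) : Icc (p i) (p (i + 1)) ⊆ Icc a b := Icc_subset_Icc
    (ht.1.trans (h0 ▸ hmono N.zero_le hi.le i.zero_le)) (hN ▸ hmono hi self_mem_Iic hi)
  have hdist {i : ℕ} (hi : i < N) {y} (hy : y ∈ Icc (p i) (p (i + 1))) : dist y (x i) < δ :=
    (Real.dist_le_of_mem_Icc hy ⟨(hx i hi).1, (hx i hi).2.1⟩).trans_lt (hx i hi).2.2
  have hbound := hC N p hle (h0 ▸ ht.1) hN.le _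
    (fun i ξ s => φ ξ s - G ξ s *ᵥ F (x i)) (fun i => hφ.sub_mulVec hK hG (F (x i)))
    (ε / (C + 1)) (by positivity) (fun i hi s hs =>
      have hq : p (i + 1) ∈ Icc (p i) (p (i + 1)) := ⟨hle i hi, le_rfl⟩
      hsmall (x i) (hcell i hi ⟨(hx i hi).1, (hx i hi).2.1⟩) _ (hcell i hi hq) s (hcell i hi hs)
        (hdist hi hq) (hdist hi hs)) t ⟨ht.1, h0.ge⟩
  calc _ ≤ ∑ i ∈ Finset.range N, ‖φ (p (i + 1)) t - G (p (i + 1)) t *ᵥ F (x i) -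
          (φ (p i) t - G (p i) t *ᵥ F (x i))‖ :=
        norm_sum_le_of_le _ fun i _ => by rw [Matrix.sub_mulVec, sub_sub_sub_comm]
    _ ≤ C * (ε / (C + 1)) := hbound
    _ < ε := by
        rw [mul_div_left_comm]
        exact mul_lt_of_lt_one_right hε ((div_lt_one (by positivity)).2 (lt_add_one C))

end MatrixFamilies

section AbsolutelyContinuous

lemma exists_finset_sum_dist_lt {X : Type*} [PseudoMetricSpace X] {h : ℝ → X} {a b : ℝ}
    (hab : a ≤ b) (hh : AbsolutelyContinuousOnInterval h a b) {ε : ℝ} (hε : 0 < ε) :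
    ∃ δ > 0, ∀ (I : Finset ℕ) (α β : ℕ → ℝ), (∀ i ∈ I, a ≤ α i ∧ α i ≤ β i ∧ β i ≤ b) →
      ((I : Set ℕ).PairwiseDisjoint fun i => Ioc (α i) (β i)) → ∑ i ∈ I, (β i - α i) < δ →
      ∑ i ∈ I, dist (h (α i)) (h (β i)) < ε := by
  obtain ⟨δ, hδ, H⟩ := (absolutelyContinuousOnInterval_iff _ _ _).1 hh ε hε
  refine ⟨δ, hδ, fun I α β hI hdisj hlen => ?_⟩
  let E : ℕ → ℝ × ℝ := fun i => if i ∈ I then (α i, β i) else (a, a)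
  have hsub : I ⊆ Finset.range (I.sup id + 1) := fun i hi =>
    Finset.mem_range.2 (Nat.lt_succ_of_le (Finset.le_sup (f := id) hi))
  have hsum (r : ℝ → ℝ → ℝ) (hr : r a a = 0) :
      ∑ i ∈ Finset.range (I.sup id + 1), r (E i).1 (E i).2 = ∑ i ∈ I, r (α i) (β i) := by
    rw [← Finset.sum_subset hsub fun i _ hi => by simp only [E, if_neg hi, hr]]
    exact Finset.sum_congr rfl fun i hi => by simp only [E, if_pos hi]
  refine (hsum (fun x y => dist (h x) (h y)) (dist_self _)).symm.trans_lt
    (H (I.sup id + 1, E) ⟨fun i _ => ?_, fun i _ j _ hij => ?_⟩ ?_)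
  · rw [uIcc_of_le hab]
    by_cases hi : i ∈ I
    · obtain ⟨h1, h2, h3⟩ := hI i hi
      simp only [E, if_pos hi]
      exact ⟨⟨h1, h2.trans h3⟩, ⟨h1.trans h2, h3⟩⟩
    · simp only [E, if_neg hi, left_mem_Icc, hab, and_self]
  · by_cases hi : i ∈ I <;> by_cases hj : j ∈ I <;> simp only [Function.onFun, E, hi, hj, if_true,
      if_false, uIoc_of_le le_rfl, Ioc_self, disjoint_empty, empty_disjoint]
    simpa only [uIoc_of_le (hI i hi).2.1, uIoc_of_le (hI j hj).2.1] using hdisj hi hj hij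
  · refine (hsum dist (dist_self a)).trans_lt
      (lt_of_eq_of_lt (Finset.sum_congr rfl fun i hi => ?_) hlen)
    rw [dist_comm, Real.dist_eq, abs_of_nonneg (sub_nonneg.2 (hI i hi).2.1)]

lemma absolutelyContinuousOnInterval_of_finset {X : Type*} [PseudoMetricSpace X] {h : ℝ → X}
    {a b : ℝ} (hab : a ≤ b)
    (hh : ∀ ε > 0, ∃ δ > 0, ∀ (I : Finset ℕ) (α β : ℕ → ℝ),
      (∀ i ∈ I, a ≤ α i ∧ α i ≤ β i ∧ β i ≤ b) →
      ((I : Set ℕ).PairwiseDisjoint fun i => Ioc (α i) (β i)) → ∑ i ∈ I, (β i - α i) < δ →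
      ∑ i ∈ I, dist (h (α i)) (h (β i)) < ε) : AbsolutelyContinuousOnInterval h a b := by
  refine (absolutelyContinuousOnInterval_iff _ _ _).2 fun ε hε => ?_
  obtain ⟨δ, hδ, H⟩ := hh ε hε
  refine ⟨δ, hδ, fun ⟨N, E⟩ ⟨hE, hdisj⟩ hlen => ?_⟩
  refine lt_of_eq_of_lt (Finset.sum_congr rfl fun i _ => ?_) (H (Finset.range N)
    (fun i => min (E i).1 (E i).2) (fun i => max (E i).1 (E i).2) (fun i hi => ?_) hdisj
    (lt_of_eq_of_lt (Finset.sum_congr rfl fun i _ => ?_) hlen))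
  · rcases le_total (E i).1 (E i).2 with hle | hle
    · rw [min_eq_left hle, max_eq_right hle]
    · rw [min_eq_right hle, max_eq_left hle, dist_comm]
  · obtain ⟨h1, h2⟩ := hE i hi
    rw [uIcc_of_le hab] at h1 h2
    exact ⟨le_min h1.1 h2.1, min_le_max, max_le h1.2 h2.2⟩
  · rw [max_sub_min_eq_abs, abs_sub_comm, Real.dist_eq]

lemma exists_sum_norm_reflect_sub_lt {V : Type*} [SeminormedAddCommGroup V] {f : ℝ → V} {a b : ℝ}
    (hab : a ≤ b) (hf : AbsolutelyContinuousOnInterval f a b) {ε : ℝ} (hε : 0 < ε) :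
    ∃ δ > 0, ∀ (I : Finset ℕ) (α β : ℕ → ℝ), (∀ i ∈ I, a ≤ α i ∧ α i ≤ β i ∧ β i ≤ b) →
      ((I : Set ℕ).PairwiseDisjoint fun i => Ioc (α i) (β i)) → ∑ i ∈ I, (β i - α i) < δ →
      ∀ t ∈ Icc a b, activeSum I α (fun i t => ‖f (β i + a - t) - f (α i + a - t)‖) t < ε := by
  obtain ⟨δ, hδ, h⟩ := exists_finset_sum_dist_lt hab hf hε
  refine ⟨δ, hδ, fun I α β hI hdisj hlen t ht => ?_⟩
  simp only [activeSum, ← dist_eq_norm]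
  refine lt_of_eq_of_lt (Finset.sum_congr rfl fun i _ => dist_comm _ _)
    (h {i ∈ I | t ≤ α i} (fun i => α i + a - t) (fun i => β i + a - t) (fun i hi => ?_)
      (fun i hi j hj hij => ?_) (lt_of_le_of_lt ?_ hlen))
  · obtain ⟨hi, hti⟩ := Finset.mem_filter.1 hi
    obtain ⟨-, h2, h3⟩ := hI i hi
    exact ⟨by linarith, by linarith, by linarith [ht.1]⟩
  · simpa only [Function.onFun, preimage_sub_const_Ioc, add_sub_assoc] using
      (hdisj (Finset.mem_filter.1 hi).1 (Finset.mem_filter.1 hj).1 hij).preimage (· - (a - t))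
  · simp only [sub_sub_sub_cancel_right, add_sub_add_right_eq_sub]
    exact Finset.sum_le_sum_of_subset_of_nonneg (Finset.filter_subset _ _) fun i hi _ =>
      sub_nonneg.2 (hI i hi).2.1

variable {V : Type*} [NormedAddCommGroup V] [NormedSpace ℝ V] [FiniteDimensional ℝ V]
  {k : ℝ → V →L[ℝ] V} {a b : ℝ}

/-- The reflected family `φ ξ (ξ + a - t)` brings the diagonal values to the common point `t = a`,
where every increment is active. -/
lemma InjectiveTruncations.exists_sum_norm_diag_sub_le (hinj : InjectiveTruncations k a b)
    (hk : Integrable k) (heven : ∀ x, k (-x) = k x) (hab : a ≤ b) :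
    ∃ C, 0 ≤ C ∧ ∀ (f : ℝ → V) (φ : ℝ → ℝ → V), IsSolutionFamily k a b f φ →
      ∀ m, (∀ ξ ∈ Icc a b, ∀ t ∈ Icc a b, ‖φ ξ t‖ ≤ m) → ∀ (I : Finset ℕ) (α β : ℕ → ℝ),
      (∀ i ∈ I, a ≤ α i ∧ α i ≤ β i ∧ β i ≤ b) → ∀ e, (∀ t ∈ Icc a b,
        activeSum I α (fun i t => ‖f (β i + a - t) - f (α i + a - t)‖ +
          m * ∫ s in α i..β i, ‖k (t - s)‖) t ≤ e) →
      ∑ i ∈ I, ‖φ (β i) (β i) - φ (α i) (α i)‖ ≤ C * e := by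
  obtain ⟨C, hC0, hC⟩ := hinj.exists_activeSum_norm_sub_le hk hab
  refine ⟨C, hC0, fun f φ hφ m hm I α β hI e he => ?_⟩
  have hcont (ξ : ℝ) : Continuous fun t => φ ξ (ξ + a - t) :=
    (hφ.continuous_apply ξ).comp (continuous_const.sub continuous_id)
  have heq {ξ : ℝ} (hξ : ξ ∈ Icc a b) {t : ℝ} (ht : t ∈ Icc a ξ) :
      φ ξ (ξ + a - t) + truncConv k a ξ (fun t => φ ξ (ξ + a - t)) t = f (ξ + a - t) := by
    rw [truncConv_reflect (u := φ ξ) heven]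
    exact hφ.eq ξ hξ _ ⟨by linarith [ht.2], by linarith [ht.1, hξ.2]⟩
  have hactive := hC I α β hI (fun i t => φ (β i) (β i + a - t))
    (fun i t => φ (α i) (α i + a - t)) (fun i t => f (β i + a - t)) (fun i t => f (α i + a - t))
    (fun i _ => hcont _) (fun i _ => hcont _)
    (fun i hi t ht => heq ⟨(hI i hi).1.trans (hI i hi).2.1, (hI i hi).2.2⟩
      ⟨ht.1, ht.2.trans (hI i hi).2.1⟩)
    (fun i hi t ht => heq ⟨(hI i hi).1, (hI i hi).2.1.trans (hI i hi).2.2⟩ ht) m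
    (fun i hi s hs => hm _ ⟨(hI i hi).1.trans (hI i hi).2.1, (hI i hi).2.2⟩ _
      ⟨by linarith [hs.2, (hI i hi).1], by linarith [hs.1, hI i hi]⟩) e he a (left_mem_Icc.2 hab)
  rw [activeSum, Finset.filter_true_of_mem fun i hi => (hI i hi).1] at hactive
  simpa only [add_sub_cancel_right] using hactive

theorem InjectiveTruncations.absolutelyContinuousOnInterval_diag
    (hinj : InjectiveTruncations k a b) (hk : Integrable k) (heven : ∀ x, k (-x) = k x)
    (hab : a ≤ b) {f : ℝ → V} {φ : ℝ → ℝ → V} (hφ : IsSolutionFamily k a b f φ)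
    (hf : AbsolutelyContinuousOnInterval f a b) :
    AbsolutelyContinuousOnInterval (fun ξ => φ ξ ξ) a b := by
  obtain ⟨C, hC0, hC⟩ := hinj.exists_sum_norm_diag_sub_le hk heven hab
  obtain ⟨m, hm⟩ := (isCompact_Icc.prod isCompact_Icc).exists_bound_of_continuousOn
    (s := Icc a b ×ˢ Icc a b) hφ.continuous.continuousOn
  have hm0 : 0 ≤ m := (norm_nonneg _).trans (hm (a, a) (by simp [hab]))
  refine absolutelyContinuousOnInterval_of_finset hab fun ε hε => ?_
  have hη : 0 < ε / (C * (1 + m) + 1) := by positivity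
  obtain ⟨δ₁, hδ₁, hf⟩ := exists_sum_norm_reflect_sub_lt hab hf hη
  obtain ⟨δ₂, hδ₂, hk⟩ := exists_sum_integral_norm_lt (ι := ℕ) hk hη
  refine ⟨min δ₁ δ₂, lt_min hδ₁ hδ₂, fun I α β hI hdisj hlen => ?_⟩
  have hsum := hC f φ hφ m (fun ξ hξ t ht => hm (ξ, t) ⟨hξ, ht⟩) I α β hI
    (ε / (C * (1 + m) + 1) + m * (ε / (C * (1 + m) + 1))) fun t ht => by
      have hk0 : ∀ i ∈ I, 0 ≤ ∫ s in α i..β i, ‖k (t - s)‖ := fun i hi =>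
        intervalIntegral.integral_nonneg (hI i hi).2.1 fun _ _ => norm_nonneg _
      rw [activeSum, Finset.sum_add_distrib, ← Finset.mul_sum]
      refine add_le_add (hf I α β hI hdisj (hlen.trans_le (min_le_left _ _)) t ht).le
        (mul_le_mul_of_nonneg_left ?_ hm0)
      exact (Finset.sum_le_sum_of_subset_of_nonneg (Finset.filter_subset _ _) fun i hi _ =>
        hk0 i hi).trans (hk I α β (fun i hi => (hI i hi).2.1) hdisj
          (hlen.trans_le (min_le_right _ _)) t).le
  simp only [dist_eq_norm']
  calc _ ≤ C * (ε / (C * (1 + m) + 1) + m * (ε / (C * (1 + m) + 1))) := hsum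
    _ = ε * (C * (1 + m) / (C * (1 + m) + 1)) := by ring
    _ < ε := mul_lt_of_lt_one_right hε ((div_lt_one (by positivity)).2 (lt_add_one _))

end AbsolutelyContinuous

section FundamentalTheorem

lemma absolutelyContinuousOnInterval_of_dist_le {X Y : Type*} [PseudoMetricSpace X]
    [PseudoMetricSpace Y] {F : ℝ → X} {h : ℝ → Y} {a b C : ℝ}
    (hh : AbsolutelyContinuousOnInterval h a b)
    (hle : ∀ x ∈ uIcc a b, ∀ y ∈ uIcc a b, dist (F x) (F y) ≤ C * dist (h x) (h y)) :
    AbsolutelyContinuousOnInterval F a b := by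
  refine squeeze_zero' (Eventually.of_forall fun E => Finset.sum_nonneg fun _ _ => dist_nonneg) ?_
    (by simpa only [mul_zero] using Tendsto.const_mul C hh)
  filter_upwards [mem_inf_of_right (mem_principal_self _)] with E hE
  rw [Finset.mul_sum]
  exact Finset.sum_le_sum fun i hi => hle _ (hE.1 i hi).1 _ (hE.1 i hi).2

lemma absolutelyContinuousOnInterval_prodMk {X Y : Type*} [PseudoMetricSpace X]
    [PseudoMetricSpace Y] {f : ℝ → X} {g : ℝ → Y} {a b : ℝ}
    (hf : AbsolutelyContinuousOnInterval f a b) (hg : AbsolutelyContinuousOnInterval g a b) :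
    AbsolutelyContinuousOnInterval (fun x => (f x, g x)) a b := by
  refine squeeze_zero (fun E => Finset.sum_nonneg fun _ _ => dist_nonneg) (fun E => ?_)
    (by simpa only [add_zero] using Tendsto.add hf hg)
  rw [← Finset.sum_add_distrib]
  exact Finset.sum_le_sum fun i _ => max_le_add_of_nonneg dist_nonneg dist_nonneg

variable {V : Type*} [NormedAddCommGroup V] [NormedSpace ℝ V] [FiniteDimensional ℝ V]
  {F : ℝ → V} {a b : ℝ}

lemma intervalIntegrable_clm_deriv_and_integral_eq_sub
    (hF : AbsolutelyContinuousOnInterval F a b) (L : V →L[ℝ] ℝ) :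
    IntervalIntegrable (fun x => L (deriv F x)) volume a b ∧
      ∫ x in a..b, L (deriv F x) = L (F b) - L (F a) := by
  have hLF : AbsolutelyContinuousOnInterval (fun x => L (F x)) a b :=
    absolutelyContinuousOnInterval_of_dist_le hF fun x _ y _ => L.lipschitz.dist_le_mul _ _
  have hderiv : ∀ᵐ x, x ∈ uIoc a b → deriv (fun x => L (F x)) x = L (deriv F x) := by
    filter_upwards [hF.boundedVariationOn.ae_differentiableAt_of_mem_uIcc] with x hx hxm
    exact (L.hasFDerivAt.comp_hasDerivAt x (hx (uIoc_subset_uIcc hxm)).hasDerivAt).deriv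
  refine ⟨hLF.intervalIntegrable_deriv.congr_ae
    ((ae_restrict_iff' measurableSet_uIoc).2 hderiv), ?_⟩
  rw [← hLF.integral_deriv_eq_sub]
  exact intervalIntegral.integral_congr_ae (hderiv.mono fun x hx hxm => (hx hxm).symm)

theorem intervalIntegrable_deriv_of_absolutelyContinuousOnInterval
    (hF : AbsolutelyContinuousOnInterval F a b) : IntervalIntegrable (deriv F) volume a b := by
  let e : V ≃L[ℝ] (Fin (Module.finrank ℝ V) → ℝ) := (Module.finBasis ℝ V).equivFunL
  have he : IntervalIntegrable (fun x => e (deriv F x)) volume a b :=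
    intervalIntegrable_iff.2 <| Integrable.of_eval fun i => intervalIntegrable_iff.1
      (intervalIntegrable_clm_deriv_and_integral_eq_sub hF
        ((ContinuousLinearMap.proj (R := ℝ) (φ := fun _ => ℝ) i).comp
          e.toContinuousLinearMap)).1
  refine intervalIntegrable_iff.2 (((e.symm : _ →L[ℝ] V).integrable_comp
    (intervalIntegrable_iff.1 he)).congr (ae_of_all _ fun x => e.symm_apply_apply _))

theorem integral_deriv_eq_sub_of_absolutelyContinuousOnInterval
    (hF : AbsolutelyContinuousOnInterval F a b) : ∫ x in a..b, deriv F x = F b - F a := by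
  have : CompleteSpace V := FiniteDimensional.complete ℝ V
  refine (SeparatingDual.eq_iff_forall_dual_eq (R := ℝ)).2 fun L => ?_
  rw [← L.intervalIntegral_comp_comm
    (intervalIntegrable_deriv_of_absolutelyContinuousOnInterval hF),
    (intervalIntegrable_clm_deriv_and_integral_eq_sub hF L).2, map_sub]

end FundamentalTheorem

section Quotient

open scoped Matrix.Norms.Operator

variable {n : ℕ} {A : ℝ → Matrix (Fin n) (Fin n) ℂ} {F h : ℝ → Fin n → ℂ} {a b : ℝ}

lemma continuousOn_matrix_inv {S : Set ℝ} (hA : ContinuousOn A S)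
    (hdet : ∀ x ∈ S, (A x).det ≠ 0) : ContinuousOn (fun x => (A x)⁻¹) S := by
  simp only [Matrix.inv_def, Ring.inverse_eq_inv']
  exact ((continuous_id.matrix_det.comp_continuousOn hA).inv₀ hdet).smul
    (continuous_id.matrix_adjugate.comp_continuousOn hA)

theorem absolutelyContinuousOnInterval_of_eq_mulVec (hab : a ≤ b)
    (hh : AbsolutelyContinuousOnInterval h a b) (hA : AbsolutelyContinuousOnInterval A a b)
    (hdet : ∀ ξ ∈ Icc a b, (A ξ).det ≠ 0) (hF : ContinuousOn F (Icc a b))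
    (hAF : ∀ ξ ∈ Icc a b, h ξ = A ξ *ᵥ F ξ) : AbsolutelyContinuousOnInterval F a b := by
  have hAc : ContinuousOn A (Icc a b) := uIcc_of_le hab ▸ hA.continuousOn
  obtain ⟨D, hD⟩ := isCompact_Icc.exists_bound_of_continuousOn
    (continuousOn_matrix_inv hAc hdet)
  obtain ⟨m, hm⟩ := isCompact_Icc.exists_bound_of_continuousOn hF
  refine absolutelyContinuousOnInterval_of_dist_le (C := D * (1 + m))
    (absolutelyContinuousOnInterval_prodMk hh hA) fun x hx y hy => ?_
  rw [uIcc_of_le hab] at hx hy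
  have hdiff : F x - F y = (A x)⁻¹ *ᵥ (h x - h y - (A x - A y) *ᵥ F y) := by
    rw [hAF x hx, hAF y hy, Matrix.sub_mulVec, sub_sub_sub_cancel_right, ← Matrix.mulVec_sub,
      Matrix.mulVec_mulVec, Matrix.nonsing_inv_mul _ (hdet x hx).isUnit, Matrix.one_mulVec]
  have : 0 ≤ m := (norm_nonneg _).trans (hm y hy)
  calc dist (F x) (F y) = ‖(A x)⁻¹ *ᵥ (h x - h y - (A x - A y) *ᵥ F y)‖ := by
        rw [dist_eq_norm, hdiff]
    _ ≤ ‖(A x)⁻¹‖ * (‖h x - h y‖ + ‖A x - A y‖ * ‖F y‖) :=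
        (Matrix.linfty_opNorm_mulVec _ _).trans <| mul_le_mul_of_nonneg_left
          ((norm_sub_le _ _).trans (add_le_add_right (Matrix.linfty_opNorm_mulVec _ _) _))
          (norm_nonneg _)
    _ ≤ D * (dist (h x, A x) (h y, A y) + dist (h x, A x) (h y, A y) * m) := by
        rw [← dist_eq_norm, ← dist_eq_norm]
        gcongr
        exacts [(norm_nonneg _).trans (hD x hx), hD x hx, le_max_left _ _, le_max_right _ _,
          hm y hy]
    _ = D * (1 + m) * dist (h x, A x) (h y, A y) := by ring

end Quotient

section UniqueSolvability

variable {V : Type*} [NormedAddCommGroup V] [NormedSpace ℝ V] {k : ℝ → V →L[ℝ] V} {a b : ℝ}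
  {T : ℝ → (ℝ → V) → ℝ → V}

lemma exists_continuous_eqOn {E : Type*} [TopologicalSpace E] {c d : ℝ} (hcd : c ≤ d)
    {u : ℝ → E} (hu : ContinuousOn u (Icc c d)) :
    ∃ v : ℝ → E, Continuous v ∧ EqOn u v (Icc c d) :=
  ⟨IccExtend hcd ((Icc c d).domRestrict u), hu.domRestrict.Icc_extend',
    fun t ht => by rw [IccExtend_of_mem hcd _ ht]; rfl⟩

lemma InjectiveTruncations.isUniqueOn (hinj : InjectiveTruncations k a b) (hk : Integrable k)
    {f f' : ℝ → V} {φ : ℝ → ℝ → V} (hφ : IsSolutionFamily k a b f' φ) (hf : EqOn f f' (Icc a b))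
    {ξ : ℝ} (hξ : ξ ∈ Icc a b)
    (hT : ∀ u v, Continuous v → EqOn u v (Icc a ξ) → EqOn (T ξ u) (truncConv k a ξ v) (Icc a ξ)) :
    IsUniqueOn (fun u => ContinuousOn u (Icc a ξ) ∧ ∀ t ∈ Icc a ξ, u t + T ξ u t = f t) a ξ
      (φ ξ) := by
  have hsub : Icc a ξ ⊆ Icc a b := Icc_subset_Icc_right hξ.2
  have hφξ := hφ.continuous_apply ξ
  refine ⟨⟨hφξ.continuousOn, fun t ht => ?_⟩, fun u hu => ?_⟩
  · rw [hT _ _ hφξ (fun _ _ => rfl) ht, hφ.eq ξ hξ t (hsub ht), hf (hsub ht)]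
  · obtain ⟨v, hv, huv⟩ := exists_continuous_eqOn hξ.1 hu.1
    refine huv.trans (hinj.eqOn hk hξ hv hφξ fun t ht => ?_)
    rw [hφ.eq ξ hξ t (hsub ht), ← hf (hsub ht), ← hu.2 t ht, hT u v hv huv ht, huv ht]

lemma injectiveTruncations_of_isUniqueOn (hk : Integrable k) {f : ℝ → V} {g : ℝ → ℝ → V}
    (hT : ∀ ξ ∈ Icc a b, ∀ u v, Continuous v → EqOn u v (Icc a ξ) →
      EqOn (T ξ u) (truncConv k a ξ v) (Icc a ξ))
    (hg : ∀ ξ ∈ Icc a b, IsUniqueOn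
      (fun u => ContinuousOn u (Icc a ξ) ∧ ∀ t ∈ Icc a ξ, u t + T ξ u t = f t) a ξ
      fun t => g t ξ) : InjectiveTruncations k a b := by
  intro ξ hξ u hu hu0 t ht
  obtain ⟨v, hv, hgv⟩ := exists_continuous_eqOn hξ.1 (hg ξ hξ).1.1
  have huniq := (hg ξ hξ).2 (fun s => v s + u s) ⟨(hv.add hu).continuousOn, fun s hs => ?_⟩ ht
  · exact add_eq_left.1 (huniq.trans (hgv ht))
  · beta_reduce
    rw [hT ξ hξ _ (fun s => v s + u s) (hv.add hu) (fun _ _ => rfl) hs,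
      truncConv_add hk hv hu, add_add_add_comm, hu0 s hs, add_zero, ← hT ξ hξ _ v hv hgv hs,
      ← hgv hs, (hg ξ hξ).1.2 s hs]

end UniqueSolvability

section EvenPart

open scoped Matrix.Norms.Operator

variable {n : ℕ} {H : ℝ → Matrix (Fin n) (Fin n) ℂ} {a b r : ℝ}

/-- The even integrable kernel on the line which represents the class of an even `H` on
`(-r, r)`. -/
def evenPart (H : ℝ → Matrix (Fin n) (Fin n) ℂ) (r : ℝ) : ℝ → Matrix (Fin n) (Fin n) ℂ :=
  indicator (Ioo (-r) r) fun t => (1 / 2 : ℂ) • (H t + H (-t))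

lemma neg_mem_Ioo_neg_iff {t : ℝ} : -t ∈ Ioo (-r) r ↔ t ∈ Ioo (-r) r := by
  rw [mem_Ioo, mem_Ioo, neg_lt_neg_iff, neg_lt, and_comm]

lemma evenPart_neg (H : ℝ → Matrix (Fin n) (Fin n) ℂ) (r x : ℝ) :
    evenPart H r (-x) = evenPart H r x := by
  by_cases hx : x ∈ Ioo (-r) r
  · simp only [evenPart, indicator_of_mem hx, indicator_of_mem (neg_mem_Ioo_neg_iff.2 hx), neg_neg,
      add_comm]
  · simp only [evenPart, indicator_of_notMem hx,
      indicator_of_notMem (mt neg_mem_Ioo_neg_iff.1 hx)]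

lemma integrable_evenPart (hH : IsIntegrableKernel H r) (i j : Fin n) :
    Integrable fun x => evenPart H r x i j := by
  have hind : Integrable (indicator (Ioo (-r) r) fun t => H t i j) :=
    (hH i j).integrable_indicator measurableSet_Ioo
  refine ((hind.add hind.comp_neg).const_mul (1 / 2 : ℂ)).congr (.of_forall fun t => ?_)
  by_cases ht : t ∈ Ioo (-r) r
  · simp [evenPart, ht, neg_mem_Ioo_neg_iff.2 ht, mul_add]
  · simp [evenPart, ht, mt neg_mem_Ioo_neg_iff.1 ht]

lemma evenPart_ae_eq (heven : IsEvenKernel H r) :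
    ∀ᵐ x, x ∈ Ioo (-r) r → evenPart H r x = H x ∧ evenPart H r x = H (-x) := by
  filter_upwards [(ae_restrict_iff' measurableSet_Ioo).1 heven] with x hx hxr
  have hval : evenPart H r x = H x := by
    rw [evenPart, indicator_of_mem hxr, hx hxr, ← two_smul ℂ (H x), smul_smul]
    norm_num
  exact ⟨hval, hval.trans (hx hxr).symm⟩

lemma evenPart_sub_ae_eq (heven : IsEvenKernel H (b - a)) {ξ t : ℝ} (hξ : ξ ∈ Icc a b)
    (ht : t ∈ Icc a ξ) : ∀ᵐ s, s ∈ uIoc a ξ →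
      evenPart H (b - a) (t - s) = H (t - s) ∧ evenPart H (b - a) (t - s) = H (s - t) := by
  filter_upwards [(quasiMeasurePreserving_sub_left volume t).ae (evenPart_ae_eq heven),
    Measure.ae_ne volume ξ] with s hs hsξ hsm
  rw [uIoc_of_le hξ.1] at hsm
  have hlt := lt_of_le_of_ne hsm.2 hsξ
  rw [← neg_sub t s]
  exact hs ⟨by linarith [ht.1, hξ.2], by linarith [ht.2, hξ.2, hsm.1]⟩

lemma matIntegral_eq_truncConv {K : ℝ → Matrix (Fin n) (Fin n) ℂ}
    (hK : ∀ i j, Integrable fun x => K x i j)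
    (B : Matrix (Fin n) (Fin n) ℂ →L[ℝ] Matrix (Fin n) (Fin n) ℂ →L[ℝ] Matrix (Fin n) (Fin n) ℂ)
    {ξ t : ℝ} {A v : ℝ → Matrix (Fin n) (Fin n) ℂ} (hv : Continuous v)
    (hA : ∀ᵐ s, s ∈ uIoc a ξ → A s = B (K (t - s)) (v s)) :
    matIntegral A a ξ = truncConv (fun x => B (K x)) a ξ v t := by
  ext i j
  refine Eq.trans ?_
    (clm_truncConv (Matrix.entryLinearMap ℝ ℂ i j).toContinuousLinearMap
      (integrable_clm_matrix_comp B hK) hv).symm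
  refine intervalIntegral.integral_congr_ae ?_
  filter_upwards [hA] with s hs hsm
  rw [hs hsm]
  rfl

variable (hH : IsIntegrableKernel H (b - a)) (heven : IsEvenKernel H (b - a)) {ξ : ℝ}
  (hξ : ξ ∈ Icc a b)
include hH heven hξ

lemma matIntegral_kernel_mul_eqOn {u v : ℝ → Matrix (Fin n) (Fin n) ℂ} (hv : Continuous v)
    (huv : EqOn u v (Icc a ξ)) :
    EqOn (fun t => matIntegral (fun s => H (t - s) * u s) a ξ)
      (truncConv (leftKernel (evenPart H (b - a))) a ξ v) (Icc a ξ) := fun t ht => by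
  refine matIntegral_eq_truncConv (integrable_evenPart hH) (.mul ℝ _) hv ?_
  filter_upwards [evenPart_sub_ae_eq heven hξ ht] with s hs hsm
  exact congrArg₂ (· * ·) (hs hsm).1.symm (huv (Ioc_subset_Icc_self (uIoc_of_le hξ.1 ▸ hsm)))

lemma matIntegral_mul_kernel_eqOn {u v : ℝ → Matrix (Fin n) (Fin n) ℂ} (hv : Continuous v)
    (huv : EqOn u v (Icc a ξ)) :
    EqOn (fun t => matIntegral (fun s => u s * H (s - t)) a ξ)
      (truncConv (rightKernel (evenPart H (b - a))) a ξ v) (Icc a ξ) := fun t ht => by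
  refine matIntegral_eq_truncConv (K := evenPart H (b - a)) (integrable_evenPart hH)
    (ContinuousLinearMap.mul ℝ (Matrix (Fin n) (Fin n) ℂ)).flip hv ?_
  filter_upwards [evenPart_sub_ae_eq heven hξ ht] with s hs hsm
  exact congrArg₂ (· * ·) (huv (Ioc_subset_Icc_self (uIoc_of_le hξ.1 ▸ hsm))) (hs hsm).2.symm

omit hH in
lemma integral_kernel_mulVec_eqOn {u v : ℝ → Fin n → ℂ} (huv : EqOn u v (Icc a ξ)) :
    EqOn (fun t => ∫ s in a..ξ, H (t - s) *ᵥ u s)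
      (truncConv (vecKernel (evenPart H (b - a))) a ξ v) (Icc a ξ) := fun t ht => by
  refine intervalIntegral.integral_congr_ae ?_
  filter_upwards [evenPart_sub_ae_eq heven hξ ht] with s hs hsm
  exact congrArg₂ (· *ᵥ ·) (hs hsm).1.symm (huv (Ioc_subset_Icc_self (uIoc_of_le hξ.1 ▸ hsm)))

end EvenPart

lemma InjectiveTruncations.of_injective {V W : Type*} [NormedAddCommGroup V] [NormedSpace ℝ V]
    [NormedAddCommGroup W] [NormedSpace ℝ W] [CompleteSpace V] [CompleteSpace W]
    {k : ℝ → V →L[ℝ] V} {l : ℝ → W →L[ℝ] W} {a b : ℝ} (hinj : InjectiveTruncations k a b)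
    (hl : Integrable l) (P : W →L[ℝ] V) (hP : ∀ x w, P (l x w) = k x (P w))
    (hPinj : Function.Injective P) : InjectiveTruncations l a b := fun ξ hξ u hu hu0 t ht =>
  (map_eq_zero_iff P hPinj).1 <| hinj ξ hξ (fun s => P (u s)) (P.continuous.comp hu) (fun s hs => by
    rw [← map_truncConv P hP hl hu, ← map_add, hu0 s hs, map_zero]) t ht

lemma InjectiveTruncations.map_const_eq_zero {V : Type*} [NormedAddCommGroup V] [NormedSpace ℝ V]
    [FiniteDimensional ℝ V] {k : ℝ → V →L[ℝ] V} {a b ξ : ℝ} {c : V} {φ : ℝ → ℝ → V}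
    (hinj : InjectiveTruncations k a b) (hk : Integrable k) (heven : ∀ x, k (-x) = k x)
    (hφ : IsSolutionFamily k a b (fun _ => c) φ) (hξ : ξ ∈ Icc a b) (P : V →L[ℝ] V)
    (hP : ∀ x v, P (k x v) = k x (P v)) (hPφ : P (φ ξ ξ) = 0) : P c = 0 := by
  have : CompleteSpace V := FiniteDimensional.complete ℝ V
  have hPφ' := hφ.map P hP hk
  exact hinj.const_eq_zero_of_apply_eq_zero hk heven hξ (hPφ'.continuous_apply ξ)
    (fun t ht => hPφ'.eq ξ hξ t ⟨ht.1, ht.2.trans hξ.2⟩) hPφ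

section FundamentalPair

open scoped Matrix.Norms.Operator

variable {n : ℕ} {K : ℝ → Matrix (Fin n) (Fin n) ℂ} {a b ξ t : ℝ}
  {G Γ : ℝ → ℝ → Matrix (Fin n) (Fin n) ℂ} {φ : ℝ → ℝ → Fin n → ℂ} {f f' : ℝ → Fin n → ℂ}

/-- The solutions `G ξ` of the truncated equations and `Γ ξ` of their duals, all with right side
`1`, for an even integrable kernel `K` with injective truncations. -/
structure IsFundamentalPair (K : ℝ → Matrix (Fin n) (Fin n) ℂ) (a b : ℝ)
    (G Γ : ℝ → ℝ → Matrix (Fin n) (Fin n) ℂ) : Prop where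
  integrable : ∀ i j, Integrable fun x => K x i j
  even : ∀ x, K (-x) = K x
  injective : InjectiveTruncations (leftKernel K) a b
  left : IsSolutionFamily (leftKernel K) a b (fun _ => 1) G
  right : IsSolutionFamily (rightKernel K) a b (fun _ => 1) Γ

lemma InjectiveTruncations.to_vecKernel (hinj : InjectiveTruncations (leftKernel K) a b)
    (hK : ∀ i j, Integrable fun x => K x i j) : InjectiveTruncations (vecKernel K) a b := by
  rcases isEmpty_or_nonempty (Fin n) with hn | hn
  · exact fun _ _ _ _ _ _ _ => Subsingleton.elim _ _
  let P : (Fin n → ℂ) →ₗ[ℝ] Matrix (Fin n) (Fin n) ℂ :=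
    { toFun := Matrix.replicateCol (Fin n)
      map_add' := Matrix.replicateCol_add
      map_smul' := Matrix.replicateCol_smul }
  exact hinj.of_injective (integrable_clm_matrix_comp (mulVecCLM n) hK) P.toContinuousLinearMap
    (fun x v => Matrix.replicateCol_mulVec (K x) v) Matrix.replicateCol_injective

lemma leftKernel_rightKernel_pairing (heven : ∀ x, K (-x) = K x) (x : ℝ)
    (A C : Matrix (Fin n) (Fin n) ℂ) :
    ContinuousLinearMap.mul ℝ _ (rightKernel K x A) C =
      ContinuousLinearMap.mul ℝ _ A (leftKernel K (-x) C) := by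
  have h : A * K x * C = A * (K (-x) * C) := by rw [heven, Matrix.mul_assoc]
  exact h

lemma InjectiveTruncations.to_rightKernel (hinj : InjectiveTruncations (leftKernel K) a b)
    (hK : ∀ i j, Integrable fun x => K x i j) (heven : ∀ x, K (-x) = K x) :
    InjectiveTruncations (rightKernel K) a b :=
  InjectiveTruncations.dual (k := leftKernel K) (l := rightKernel K)
    (B := ContinuousLinearMap.mul ℝ (Matrix (Fin n) (Fin n) ℂ)) hinj
    (leftKernel_rightKernel_pairing heven)
    (fun A hA => (Matrix.mul_one A).symm.trans (hA 1))
    (integrable_clm_matrix_comp (ContinuousLinearMap.mul ℝ _) hK)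
    (integrable_clm_matrix_comp (ContinuousLinearMap.mul ℝ (Matrix (Fin n) (Fin n) ℂ)).flip hK)

theorem exists_isFundamentalPair (hab : a ≤ b) (hK : ∀ i j, Integrable fun x => K x i j)
    (heven : ∀ x, K (-x) = K x) (hinj : InjectiveTruncations (leftKernel K) a b) :
    ∃ G Γ, IsFundamentalPair K a b G Γ := by
  obtain ⟨_, -, hleft⟩ := hinj.exists_isSolutionFamily
    (integrable_clm_matrix_comp (ContinuousLinearMap.mul ℝ _) hK) hab
  obtain ⟨_, -, hright⟩ := (hinj.to_rightKernel hK heven).exists_isSolutionFamily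
    (integrable_clm_matrix_comp (ContinuousLinearMap.mul ℝ (Matrix (Fin n) (Fin n) ℂ)).flip hK) hab
  obtain ⟨G, hG, -⟩ := hleft _ continuous_const
  obtain ⟨Γ, hΓ, -⟩ := hright _ continuous_const
  exact ⟨G, Γ, hK, heven, hinj, hG, hΓ⟩

namespace IsFundamentalPair

variable (hp : IsFundamentalPair K a b G Γ)
include hp

lemma det_left_ne_zero (hξ : ξ ∈ Icc a b) : (G ξ ξ).det ≠ 0 := fun h => by
  obtain ⟨v, hv, hGv⟩ := Matrix.exists_mulVec_eq_zero_iff.2 h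
  have hzero : (1 : Matrix (Fin n) (Fin n) ℂ) * Matrix.vecMulVec v v = 0 :=
    InjectiveTruncations.map_const_eq_zero (k := leftKernel K) hp.injective
      (integrable_clm_matrix_comp (ContinuousLinearMap.mul ℝ _) hp.integrable)
      (fun x => congrArg (ContinuousLinearMap.mul ℝ _) (hp.even x)) hp.left hξ
      ((ContinuousLinearMap.mul ℝ (Matrix (Fin n) (Fin n) ℂ)).flip (Matrix.vecMulVec v v))
      (fun x A => Matrix.mul_assoc (K x) A _)
      ((Matrix.mul_vecMulVec (G ξ ξ) v v).trans (by rw [hGv, Matrix.zero_vecMulVec]))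
  rw [Matrix.one_mul] at hzero
  exact Matrix.vecMulVec_ne_zero hv hv hzero

lemma det_right_ne_zero (hξ : ξ ∈ Icc a b) : (Γ ξ ξ).det ≠ 0 := fun h => by
  obtain ⟨v, hv, hΓv⟩ := Matrix.exists_vecMul_eq_zero_iff.2 h
  have hzero : Matrix.vecMulVec v v * (1 : Matrix (Fin n) (Fin n) ℂ) = 0 :=
    InjectiveTruncations.map_const_eq_zero (k := rightKernel K)
      (hp.injective.to_rightKernel hp.integrable hp.even)
      (integrable_clm_matrix_comp
        (ContinuousLinearMap.mul ℝ (Matrix (Fin n) (Fin n) ℂ)).flip hp.integrable)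
      (fun x => congrArg (ContinuousLinearMap.mul ℝ (Matrix (Fin n) (Fin n) ℂ)).flip (hp.even x))
      hp.right hξ (ContinuousLinearMap.mul ℝ (Matrix (Fin n) (Fin n) ℂ) (Matrix.vecMulVec v v))
      (fun x A => (Matrix.mul_assoc _ A (K x)).symm)
      ((Matrix.vecMulVec_mul v v (Γ ξ ξ)).trans (by rw [hΓv, Matrix.vecMulVec_zero]))
  rw [Matrix.mul_one] at hzero
  exact Matrix.vecMulVec_ne_zero hv hv hzero

end IsFundamentalPair

end FundamentalPair

section KreinFunction

open scoped Matrix.Norms.Operator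

variable {n : ℕ} {K : ℝ → Matrix (Fin n) (Fin n) ℂ} {a b ξ t : ℝ}
  {g G Γ : ℝ → ℝ → Matrix (Fin n) (Fin n) ℂ} {φ : ℝ → ℝ → Fin n → ℂ} {f f' : ℝ → Fin n → ℂ}

lemma HasStieltjesIntegral.integral_mulVec_deriv_eq {A : ℝ → Matrix (Fin n) (Fin n) ℂ}
    {F : ℝ → Fin n → ℂ} {c d : ℝ} {J : Fin n → ℂ} (h : HasStieltjesIntegral A F c d J)
    (hcd : c ≤ d) (hA : ContinuousOn A (Icc c d)) (hF : AbsolutelyContinuousOnInterval F c d) :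
    ∫ ξ in c..d, A ξ *ᵥ deriv F ξ = J := by
  refine HasStieltjesIntegral.unique hcd (hasStieltjesIntegral_integral_mulVec hcd hA
    (intervalIntegrable_deriv_of_absolutelyContinuousOnInterval hF) fun x hx y hy => ?_) h
  exact (integral_deriv_eq_sub_of_absolutelyContinuousOnInterval
    (hF.mono (uIcc_subset_uIcc (Icc_subset_uIcc hx) (Icc_subset_uIcc hy)))).symm

lemma matDerivWithin_eq {M : ℝ → Matrix (Fin n) (Fin n) ℂ} {M' : Matrix (Fin n) (Fin n) ℂ}
    {S : Set ℝ} (hS : UniqueDiffWithinAt ℝ S ξ)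
    (hM : ∀ i j, HasDerivWithinAt (fun η => M η i j) (M' i j) S ξ) :
    matDerivWithin M S ξ = M' := by
  ext i j
  exact (hM i j).derivWithin hS

lemma eqOn_Icc_right_of_eqOn_Icc_left (hg : ∀ ξ ∈ Icc a b, EqOn (fun t => g t ξ) (G ξ) (Icc a ξ))
    (ht : t ∈ Icc a b) : EqOn (g t) (fun ξ => G ξ t) (Icc t b) := fun ξ hξ =>
  hg ξ ⟨ht.1.trans hξ.1, hξ.2⟩ ⟨ht.1, hξ.1⟩

namespace IsFundamentalPair

variable (hp : IsFundamentalPair K a b G Γ)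
include hp

lemma hasDerivWithinAt_M (hg : ∀ ξ ∈ Icc a b, EqOn (fun t => g t ξ) (G ξ) (Icc a ξ))
    (hξ : ξ ∈ Icc a b) (i j : Fin n) :
    HasDerivWithinAt (fun η => M g a η i j) ((Γ ξ ξ * g ξ ξ) i j) (Icc a b) ξ := by
  let L : Matrix (Fin n) (Fin n) ℂ →L[ℝ] ℂ := (Matrix.entryLinearMap ℝ ℂ i j).toContinuousLinearMap
  have hderiv := hasDerivWithinAt_integral_pairing (k := leftKernel K) (l := rightKernel K)
    (B := ContinuousLinearMap.mul ℝ (Matrix (Fin n) (Fin n) ℂ))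
    (leftKernel_rightKernel_pairing hp.even)
    (integrable_clm_matrix_comp (ContinuousLinearMap.mul ℝ _) hp.integrable)
    (integrable_clm_matrix_comp
      (ContinuousLinearMap.mul ℝ (Matrix (Fin n) (Fin n) ℂ)).flip hp.integrable)
    hp.left hp.right hξ
  rw [show g ξ ξ = G ξ ξ from hg ξ hξ (right_mem_Icc.2 hξ.1)]
  refine (L.hasFDerivAt.comp_hasDerivWithinAt ξ hderiv).congr_of_mem (fun η hη => ?_) hξ
  have hG := hp.left.continuous_apply η
  refine Eq.trans (intervalIntegral.integral_congr fun s hs => ?_)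
    (L.intervalIntegral_comp_comm (Continuous.intervalIntegrable (by fun_prop) a η))
  rw [uIcc_of_le hη.1] at hs
  have hs' : g s η = 1 * G η s := (hg η hη hs).trans (Matrix.one_mul _).symm
  exact congrFun (congrFun hs' i) j

lemma hasDerivWithinAt_dualMoment (hφ : IsSolutionFamily (vecKernel K) a b f' φ)
    (hf : EqOn f f' (Icc a b)) (hξ : ξ ∈ Icc a b) :
    HasDerivWithinAt (dualMoment (fun t η => Γ η t) f a) (Γ ξ ξ *ᵥ φ ξ ξ) (Icc a b) ξ := by
  have hpair (x : ℝ) (A : Matrix (Fin n) (Fin n) ℂ) (v : Fin n → ℂ) :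
      mulVecCLM n (rightKernel K x A) v = mulVecCLM n A (vecKernel K (-x) v) := by
    have h : (A * K x) *ᵥ v = A *ᵥ (K (-x) *ᵥ v) := by rw [hp.even, Matrix.mulVec_mulVec]
    exact h
  have hvec := integrable_clm_matrix_comp (mulVecCLM n) hp.integrable
  have hright := integrable_clm_matrix_comp
    (ContinuousLinearMap.mul ℝ (Matrix (Fin n) (Fin n) ℂ)).flip hp.integrable
  refine (hasDerivWithinAt_integral_pairing (k := vecKernel K) (l := rightKernel K)
    (B := mulVecCLM n) hpair hvec hright hφ hp.right hξ).congr_of_mem (fun η hη => ?_) hξ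
  rw [integral_pairing_eq_integral_pairing (k := vecKernel K) (l := rightKernel K)
    (B := mulVecCLM n) hpair hvec hright hφ hp.right hη]
  refine intervalIntegral.integral_congr fun s hs => ?_
  rw [uIcc_of_le hη.1] at hs
  exact congrArg (Γ η s *ᵥ ·) (hf ⟨hs.1, hs.2.trans hη.2⟩)

variable (hab : a < b) (hg : ∀ ξ ∈ Icc a b, EqOn (fun t => g t ξ) (G ξ) (Icc a ξ))
  (hφ : IsSolutionFamily (vecKernel K) a b f' φ) (hf : EqOn f f' (Icc a b))
include hab hg hφ hf

lemma kreinF_eq (hξ : ξ ∈ Icc a b) :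
    kreinF g (fun t η => Γ η t) f a b ξ = (G ξ ξ)⁻¹ *ᵥ φ ξ ξ := by
  have hS := uniqueDiffOn_Icc hab ξ hξ
  rw [kreinF, matDerivWithin_eq hS (hp.hasDerivWithinAt_M hg hξ),
    (hp.hasDerivWithinAt_dualMoment hφ hf hξ).derivWithin hS,
    show g ξ ξ = G ξ ξ from hg ξ hξ (right_mem_Icc.2 hξ.1), Matrix.mul_inv_rev,
    Matrix.mulVec_mulVec, Matrix.mul_assoc,
    Matrix.nonsing_inv_mul _ (hp.det_right_ne_zero hξ).isUnit, Matrix.mul_one]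

lemma diag_eq_mulVec_kreinF (hξ : ξ ∈ Icc a b) :
    φ ξ ξ = G ξ ξ *ᵥ kreinF g (fun t η => Γ η t) f a b ξ := by
  rw [hp.kreinF_eq hab hg hφ hf hξ, Matrix.mulVec_mulVec,
    Matrix.mul_nonsing_inv _ (hp.det_left_ne_zero hξ).isUnit, Matrix.one_mulVec]

lemma continuousOn_kreinF : ContinuousOn (kreinF g (fun t η => Γ η t) f a b) (Icc a b) :=
  ((continuous_fst.matrix_mulVec continuous_snd).comp_continuousOn
    ((continuousOn_matrix_inv hp.left.continuous_diag.continuousOn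
      fun _ => hp.det_left_ne_zero).prodMk hφ.continuous_diag.continuousOn)).congr
        fun _ => hp.kreinF_eq hab hg hφ hf

lemma hasStieltjesIntegral_kreinF (ht : t ∈ Icc a b) :
    HasStieltjesIntegral (g t) (kreinF g (fun t η => Γ η t) f a b) t b
      (g t b *ᵥ kreinF g (fun t η => Γ η t) f a b b - φ b t) := by
  have hgt := eqOn_Icc_right_of_eqOn_Icc_left hg ht
  rw [hgt (right_mem_Icc.2 ht.2)]
  exact ((hp.injective.to_vecKernel hp.integrable).hasStieltjesIntegral hp.integrable hφ hp.left
    (hp.continuousOn_kreinF hab hg hφ hf)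
    (fun _ => hp.diag_eq_mulVec_kreinF hab hg hφ hf) ht).congr hgt.symm fun _ _ => rfl

lemma absolutelyContinuousOnInterval_kreinF (hac : AbsolutelyContinuousOnInterval f a b) :
    AbsolutelyContinuousOnInterval (kreinF g (fun t η => Γ η t) f a b) a b := by
  have hf' : AbsolutelyContinuousOnInterval f' a b :=
    absolutelyContinuousOnInterval_of_dist_le (C := 1) hac fun x hx y hy => by
      rw [uIcc_of_le hab.le] at hx hy
      rw [hf hx, hf hy, one_mul]
  have hφdiag := (hp.injective.to_vecKernel hp.integrable).absolutelyContinuousOnInterval_diag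
    (integrable_clm_matrix_comp (mulVecCLM n) hp.integrable)
    (fun x => congrArg (mulVecCLM n) (hp.even x)) hab.le hφ hf'
  have hGdiag := hp.injective.absolutelyContinuousOnInterval_diag
    (integrable_clm_matrix_comp (ContinuousLinearMap.mul ℝ _) hp.integrable)
    (fun x => congrArg (ContinuousLinearMap.mul ℝ _) (hp.even x)) hab.le hp.left
    (LipschitzWith.const _).lipschitzOnWith.absolutelyContinuousOnInterval
  exact absolutelyContinuousOnInterval_of_eq_mulVec hab.le hφdiag hGdiag
    (fun _ => hp.det_left_ne_zero) (hp.continuousOn_kreinF hab hg hφ hf)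
    fun _ => hp.diag_eq_mulVec_kreinF hab hg hφ hf

lemma intervalIntegrable_and_eq_sub_integral (hac : AbsolutelyContinuousOnInterval f a b)
    (ht : t ∈ Icc a b) :
    IntervalIntegrable (fun ξ => g t ξ *ᵥ deriv (kreinF g (fun t η => Γ η t) f a b) ξ)
        volume t b ∧
      φ b t = g t b *ᵥ kreinF g (fun t η => Γ η t) f a b b -
        ∫ ξ in t..b, g t ξ *ᵥ deriv (kreinF g (fun t η => Γ η t) f a b) ξ := by
  have hF : AbsolutelyContinuousOnInterval (kreinF g (fun t η => Γ η t) f a b) t b :=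
    (hp.absolutelyContinuousOnInterval_kreinF hab hg hφ hf hac).mono
      (uIcc_subset_uIcc (Icc_subset_uIcc ht) right_mem_uIcc)
  have hgt : ContinuousOn (g t) (Icc t b) :=
    (hp.left.continuous.comp (Continuous.prodMk_left t)).continuousOn.congr
      (eqOn_Icc_right_of_eqOn_Icc_left hg ht)
  refine ⟨intervalIntegrable_mulVec ht.2 hgt
    (intervalIntegrable_deriv_of_absolutelyContinuousOnInterval hF), ?_⟩
  rw [(hp.hasStieltjesIntegral_kreinF hab hg hφ hf ht).integral_mulVec_deriv_eq ht.2 hgt hF,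
    sub_sub_cancel]

end IsFundamentalPair

section Kernel

variable {H : ℝ → Matrix (Fin n) (Fin n) ℂ} (hH : IsIntegrableKernel H (b - a))
  (heven : IsEvenKernel H (b - a))
include hH heven

theorem exists_isFundamentalPair_of_isUniqueOn (hab : a ≤ b)
    (hg : ∀ ξ ∈ Icc a b, IsUniqueOn (IsTruncatedSolution H a ξ) a ξ fun t => g t ξ) :
    ∃ G Γ, IsFundamentalPair (evenPart H (b - a)) a b G Γ ∧
      ∀ ξ ∈ Icc a b, EqOn (fun t => g t ξ) (G ξ) (Icc a ξ) := by
  have hT (ξ : ℝ) (hξ : ξ ∈ Icc a b) (u v : ℝ → Matrix (Fin n) (Fin n) ℂ) (hv : Continuous v)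
      (huv : EqOn u v (Icc a ξ)) :=
    matIntegral_kernel_mul_eqOn hH heven hξ hv huv
  have hint := integrable_clm_matrix_comp (ContinuousLinearMap.mul ℝ _) (integrable_evenPart hH)
  have hinj : InjectiveTruncations (leftKernel (evenPart H (b - a))) a b :=
    injectiveTruncations_of_isUniqueOn
      (T := fun ξ u t => matIntegral (fun s => H (t - s) * u s) a ξ) hint hT hg
  obtain ⟨G, Γ, hp⟩ := exists_isFundamentalPair hab (integrable_evenPart hH) (evenPart_neg H _) hinj
  exact ⟨G, Γ, hp, fun ξ hξ => (hinj.isUniqueOn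
    (T := fun ξ u t => matIntegral (fun s => H (t - s) * u s) a ξ) hint hp.left (fun _ _ => rfl) hξ
    (hT ξ hξ)).2 _ (hg ξ hξ).1⟩

lemma IsFundamentalPair.isUniqueOn_isDualTruncatedSolution
    (hp : IsFundamentalPair (evenPart H (b - a)) a b G Γ) (hξ : ξ ∈ Icc a b) :
    IsUniqueOn (IsDualTruncatedSolution H a ξ) a ξ (Γ ξ) :=
  (hp.injective.to_rightKernel hp.integrable hp.even).isUniqueOn
    (T := fun ξ u t => matIntegral (fun s => u s * H (s - t)) a ξ)
    (integrable_clm_matrix_comp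
      (ContinuousLinearMap.mul ℝ (Matrix (Fin n) (Fin n) ℂ)).flip hp.integrable)
    hp.right (fun _ _ => rfl) hξ fun _ _ hv huv => matIntegral_mul_kernel_eqOn hH heven hξ hv huv

omit hH in
theorem IsFundamentalPair.exists_isUniqueOn_isSolution
    (hp : IsFundamentalPair (evenPart H (b - a)) a b G Γ) (hab : a ≤ b)
    (hf : ContinuousOn f (Icc a b)) :
    ∃ f' φ, EqOn f f' (Icc a b) ∧ IsSolutionFamily (vecKernel (evenPart H (b - a))) a b f' φ ∧
      IsUniqueOn (IsSolution H a b f) a b (φ b) := by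
  have hvec := hp.injective.to_vecKernel hp.integrable
  have hint := integrable_clm_matrix_comp (mulVecCLM n) hp.integrable
  obtain ⟨f', hf', hff'⟩ := exists_continuous_eqOn hab hf
  obtain ⟨_, -, hsolve⟩ := hvec.exists_isSolutionFamily hint hab
  obtain ⟨φ, hφ, -⟩ := hsolve f' hf'
  exact ⟨f', φ, hff', hφ, hvec.isUniqueOn
    (T := fun ξ u t => ∫ s in a..ξ, H (t - s) *ᵥ u s) hint hφ hff' (right_mem_Icc.2 hab)
    fun _ _ _ huv => integral_kernel_mulVec_eqOn heven (right_mem_Icc.2 hab) huv⟩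

end Kernel

end KreinFunction

end KreinMethod

end

theorem theorem4p1 {n : ℕ} {a b : ℝ} (hab : a < b)
    (H : ℝ → Matrix (Fin n) (Fin n) ℂ)
    (hH : KreinMethod.IsIntegrableKernel H (b - a))
    (heven : KreinMethod.IsEvenKernel H (b - a))
    (g : ℝ → ℝ → Matrix (Fin n) (Fin n) ℂ)
    (hg : ∀ ξ ∈ Icc a b,
      KreinMethod.IsUniqueOn (KreinMethod.IsTruncatedSolution H a ξ) a ξ (fun t => g t ξ)) :
    ∃ gs : ℝ → ℝ → Matrix (Fin n) (Fin n) ℂ,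
      -- `gs` is `g*`: the dual truncated equations are uniquely solvable
      (∀ ξ ∈ Icc a b,
        KreinMethod.IsUniqueOn (KreinMethod.IsDualTruncatedSolution H a ξ) a ξ
          (fun t => gs t ξ)) ∧
      -- nondegeneracy
      (∀ ξ ∈ Icc a b, (gs ξ ξ * g ξ ξ).det ≠ 0) ∧
      -- `M' = g*(ξ, ξ) g(ξ, ξ)`
      (∀ ξ ∈ Icc a b, ∀ i j,
        HasDerivWithinAt (fun η => KreinMethod.M g a η i j) ((gs ξ ξ * g ξ ξ) i j)
          (Icc a b) ξ) ∧
      ∀ f : ℝ → Fin n → ℂ, ContinuousOn f (Icc a b) →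
        -- the derivative inside the formula exists, and `F` is continuous
        DifferentiableOn ℝ (KreinMethod.dualMoment gs f a) (Icc a b) ∧
        ContinuousOn (KreinMethod.kreinF g gs f a b) (Icc a b) ∧
        ∃ φ : ℝ → Fin n → ℂ,
          KreinMethod.IsUniqueOn (KreinMethod.IsSolution H a b f) a b φ ∧
          -- the formula, with `∫_t^b g(t, ξ) dF(ξ)` as a Stieltjes integral
          (∀ t ∈ Icc a b, ∃ J : Fin n → ℂ,
            KreinMethod.HasStieltjesIntegral (fun ξ => g t ξ)
              (KreinMethod.kreinF g gs f a b) t b J ∧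
            φ t = g t b *ᵥ KreinMethod.kreinF g gs f a b b - J) ∧
          -- for absolutely continuous `f` the outer derivative is an honest one
          (AbsolutelyContinuousOnInterval f a b →
            AbsolutelyContinuousOnInterval (KreinMethod.kreinF g gs f a b) a b ∧
            (∀ᵐ ξ ∂(volume.restrict (Icc a b)),
              DifferentiableAt ℝ (KreinMethod.kreinF g gs f a b) ξ) ∧
            ∀ t ∈ Icc a b,
              IntervalIntegrable
                (fun ξ => g t ξ *ᵥ deriv (KreinMethod.kreinF g gs f a b) ξ) volume t b ∧
              φ t = g t b *ᵥ KreinMethod.kreinF g gs f a b b -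
                ∫ ξ in t..b, g t ξ *ᵥ deriv (KreinMethod.kreinF g gs f a b) ξ) := by
  open KreinMethod in
  obtain ⟨G, Γ, hp, hgG⟩ := exists_isFundamentalPair_of_isUniqueOn hH heven hab.le hg
  refine ⟨fun t ξ => Γ ξ t, fun ξ => hp.isUniqueOn_isDualTruncatedSolution hH heven,
    fun ξ hξ => ?_, fun ξ => hp.hasDerivWithinAt_M hgG, fun f hf => ?_⟩
  · rw [show g ξ ξ = G ξ ξ from hgG ξ hξ (right_mem_Icc.2 hξ.1), Matrix.det_mul]
    exact mul_ne_zero (hp.det_right_ne_zero hξ) (hp.det_left_ne_zero hξ)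
  obtain ⟨f', φ, hff', hφ, hunique⟩ := hp.exists_isUniqueOn_isSolution heven hab.le hf
  refine ⟨fun ξ hξ => (hp.hasDerivWithinAt_dualMoment hφ hff' hξ).differentiableWithinAt,
    hp.continuousOn_kreinF hab hgG hφ hff', φ b, hunique,
    fun t ht => ⟨_, hp.hasStieltjesIntegral_kreinF hab hgG hφ hff' ht, (sub_sub_cancel _ _).symm⟩,
    fun hac => ?_⟩
  have hFac := hp.absolutelyContinuousOnInterval_kreinF hab hgG hφ hff' hac
  refine ⟨hFac, ?_, fun t => hp.intervalIntegrable_and_eq_sub_integral hab hgG hφ hff' hac⟩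
  rw [ae_restrict_iff' measurableSet_Icc, ← uIcc_of_le hab.le]
  exact hFac.boundedVariationOn.ae_differentiableAt_of_mem_uIcc
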